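/- Let $\mathcal H,\mathcal K$ be complex Hilbert spaces, $\lambda,\mu\in\mathbb R$, and $B:\mathcal K\to\mathcal H$ a bounded linear operator with adjoint $B^*$. On $\mathcal H\oplus\mathcal K$ put $Q_{\lambda,\mu}=\begin{pmatrix}\lambda I&B\\B^*&\mu I\end{pmatrix}$, and write $|A|=(A^*A)^{1/2}$. (i) If $\lambda=\mu=0$, then $|Q_{\lambda,\mu}|=\begin{pmatrix}|B^*|&0\\0&|B|\end{pmatrix}$. (ii) If $\lambda\ne0$ and $\mu=0$, then $T=(\lambda^2I+4BB^*)^{1/2}$ is invertible and $$|Q_{\lambda,\mu}|=\begin{pmatrix}\frac{T+\lambda^2T^{-1}}2&\lambda T^{-1}B\\ \lambda B^*T^{-1}&2B^*T^{-1}B\end{pmatrix}.$$ (iii) If $\lambda\mu\ge\|B\|^2>0$, then $|Q_{\lambda,\mu}|=\frac{|\lambda|}{\lambda}Q_{\lambda,\mu}$. (iv) If $\lambda\mu<0$, then $T=[(\mu-\lambda)^2I+4BB^*]^{1/2}$ and $S=[(\mu-\lambda)^2I+4B^*B]^{1/2}$ are invertible and $$|Q_{\lambda,\mu}|=\begin{pmatrix}T^{-1}(2BB^*-\lambda\mu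 I+\lambda^2I)&(\lambda+\mu)T^{-1}B\\(\lambda+\mu)B^*T^{-1}&S^{-1}(\mu^2I-\lambda\mu I+2B^*B)\end{pmatrix}.$$ (v) Suppose $0<\lambda\mu<\|B\|^2$. Let $\widetilde B:N(B)^\perp\to\overline{R(B)}$ be the restriction of $B$, where $N$ and $R$ denote null space and range; let $\widetilde V:\overline{R(B)}\to N(B)^\perp$ be the unitary operator in the polar decomposition $\widetilde B^*=\widetilde V(\widetilde B\widetilde B^*)^{1/2}$, and let $E$ be the spectral measure of $\widetilde B\widetilde B^*$. Let $\widetilde{\mathcal H}_1$ and $\widetilde{\mathcal H}_2$ be the ranges of $E([0,\lambda\mu])$ and $E((\lambda\mu,\|B\|^2])$, and for $i=1,2$ let $\widetilde{\mathcal K}_i=\widetilde V\widetilde{\mathcal H}_i$ and let $\widetilde B_i:\widetilde{\mathcal K}_i\to\widetilde{\mathcal H}_i$ be the operator with $\widetilde B_i^*=\widetilde V|_{\widetilde{\mathcal H}_i}\,(\widetilde B\widetilde B^*|_{\widetilde{\mathcal H}_i})^{1/2}$. Then $\widetilde T=[(\mu-\lambda)^2I+4\widetilde B_2\widetilde B_2^*]^{1/2}$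 and $\widetilde S=[(\mu-\lambda)^2I+4\widetilde B_2^*\widetilde B_2]^{1/2}$ are invertible; the map $(x,y,(h_1,k_1),(h_2,k_2))\mapsto(x+h_1+h_2,\;y+k_1+k_2)$ is a unitary operator from $R(B)^\perp\oplus N(B)\oplus(\widetilde{\mathcal H}_1\oplus\widetilde{\mathcal K}_1)\oplus(\widetilde{\mathcal H}_2\oplus\widetilde{\mathcal K}_2)$ onto $\mathcal H\oplus\mathcal K$; and under this unitary operator $|Q_{\lambda,\mu}|$ corresponds to $$|\lambda|I\oplus|\mu|I\oplus|\lambda|\begin{pmatrix}I&\frac1\lambda\widetilde B_1\\ \frac1\lambda\widetilde B_1^*&\frac\mu\lambda I\end{pmatrix}\oplus\begin{pmatrix}\widetilde T^{-1}(2\widetilde B_2\widetilde B_2^*-\lambda\mu I+\lambda^2I)&(\lambda+\mu)\widetilde T^{-1}\widetilde B_2\\(\lambda+\mu)\widetilde B_2^*\widetilde T^{-1}&(\mu^2I-\lambda\mu I+2\widetilde B_2^*\widetilde B_2)\widetilde S^{-1}\end{pmatrix}.$$ (vi) If $\lambda=0$ and $\mu\ne0$, then $S=(\mu^2I+4B^*B)^{1/2}$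 is invertible and $$|Q_{\lambda,\mu}|=\begin{pmatrix}2BS^{-1}B^*&\mu BS^{-1}\\ \mu S^{-1}B^*&\frac{S+\mu^2S^{-1}}2\end{pmatrix}.$$ -/

import Mathlib

open scoped InnerProduct CompactlySupported ENNReal
open ContinuousLinearMap MeasureTheory

noncomputable section

/-! ### Square roots, absolute values, block operators -/

section Blocks

variable {E F : Type*} [NormedAddCommGroup E] [InnerProductSpace ℂ E]
  [NormedAddCommGroup F] [InnerProductSpace ℂ F]

/-- The positive square root `A^{1/2}` of a positive bounded operator `A`. -/
def opSqrt [CompleteSpace E] (A : E →L[ℂ] E) : E →L[ℂ] E := CFC.sqrt A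

/-- The absolute value `|A| = (A* A)^{1/2}` of a bounded operator `A : E → F` between Hilbert
spaces. -/
def opAbs [CompleteSpace E] [CompleteSpace F] (A : E →L[ℂ] F) : E →L[ℂ] E :=
  opSqrt (A† ∘L A)

/-- The operator with matrix `[[a, b], [c, d]]` on the Hilbert space direct sum `E ⊕ F`. -/
def blockOp (a : E →L[ℂ] E) (b : F →L[ℂ] E) (c : E →L[ℂ] F) (d : F →L[ℂ] F) :
    WithLp 2 (E × F) →L[ℂ] WithLp 2 (E × F) :=
  ((WithLp.prodContinuousLinearEquiv 2 ℂ E F).symm : E × F →L[ℂ] WithLp 2 (E × F)) ∘L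
    ((a.coprod b).prod (c.coprod d)) ∘L
    ((WithLp.prodContinuousLinearEquiv 2 ℂ E F) : WithLp 2 (E × F) →L[ℂ] E × F)

/-- The direct sum `a ⊕ d` of two operators. -/
def directSumOp (a : E →L[ℂ] E) (d : F →L[ℂ] F) :
    WithLp 2 (E × F) →L[ℂ] WithLp 2 (E × F) :=
  blockOp a 0 0 d

/-- The operator `Q_{lam,mu} = [[lam I, B], [B*, mu I]]` on `H ⊕ K`, for `B : K → H`. -/
def Qop [CompleteSpace E] [CompleteSpace F] (lam mu : ℝ) (B : F →L[ℂ] E) :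
    WithLp 2 (E × F) →L[ℂ] WithLp 2 (E × F) :=
  blockOp ((lam : ℂ) • 1) B (B†) ((mu : ℂ) • 1)

/-- `T = ((mu - lam)² I + 4 C C*)^{1/2}` on `E`, for `C : F → E`. -/
def rootT [CompleteSpace E] [CompleteSpace F] (lam mu : ℝ) (C : F →L[ℂ] E) : E →L[ℂ] E :=
  opSqrt ((((mu - lam) ^ 2 : ℝ) : ℂ) • 1 + (4 : ℂ) • (C ∘L C†))

/-- `S = ((mu - lam)² I + 4 C* C)^{1/2}` on `F`, for `C : F → E`. -/
def rootS [CompleteSpace E] [CompleteSpace F] (lam mu : ℝ) (C : F →L[ℂ] E) : F →L[ℂ] F :=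
  opSqrt ((((mu - lam) ^ 2 : ℝ) : ℂ) • 1 + (4 : ℂ) • (C† ∘L C))

/-- The operator `[[I, C/lam], [C*/lam, (mu/lam) I]]` on `E ⊕ F`, for `C : F → E`. -/
def lowBlock [CompleteSpace E] [CompleteSpace F] (lam mu : ℝ) (C : F →L[ℂ] E) :
    WithLp 2 (E × F) →L[ℂ] WithLp 2 (E × F) :=
  blockOp 1 (((1 / lam : ℝ) : ℂ) • C) (((1 / lam : ℝ) : ℂ) • C†) (((mu / lam : ℝ) : ℂ) • 1)

/-- The operator on `E ⊕ F`, for `C : F → E`, with the matrix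
`[[T⁻¹(2CC* - lam mu I + lam² I), (lam + mu) T⁻¹ C],
  [(lam + mu) C* T⁻¹, (mu² I - lam mu I + 2C*C) S⁻¹]]`,
where `T = ((mu - lam)² I + 4CC*)^{1/2}` and `S = ((mu - lam)² I + 4C*C)^{1/2}`. -/
def highBlock [CompleteSpace E] [CompleteSpace F] (lam mu : ℝ) (C : F →L[ℂ] E) :
    WithLp 2 (E × F) →L[ℂ] WithLp 2 (E × F) :=
  let T : E →L[ℂ] E := rootT lam mu C
  let S : F →L[ℂ] F := rootS lam mu C
  blockOp
    (Ring.inverse T ∘L ((2 : ℂ) • (C ∘L C†) - ((lam * mu : ℝ) : ℂ) • 1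
      + ((lam ^ 2 : ℝ) : ℂ) • 1))
    (((lam + mu : ℝ) : ℂ) • (Ring.inverse T ∘L C))
    (((lam + mu : ℝ) : ℂ) • (C† ∘L Ring.inverse T))
    ((((mu ^ 2 : ℝ) : ℂ) • 1 - ((lam * mu : ℝ) : ℂ) • 1 + (2 : ℂ) • (C† ∘L C)) ∘L Ring.inverse S)

end Blocks

/-! ### The spectral measure of a self-adjoint operator -/

section Spectral

variable {E : Type*} [NormedAddCommGroup E] [InnerProductSpace ℂ E] [CompleteSpace E]

/-- The positive functional `f ↦ ⟨f(A) x, x⟩` on `C_c(ℝ)`, with `f(A)` given by the continuous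
functional calculus of the self-adjoint operator `A`. -/
def spectralFunctional (A : E →L[ℂ] E) (x : E) : C_c(ℝ, ℝ) →ₚ[ℝ] ℝ :=
  PositiveLinearMap.mk₀
    { toFun := fun f => RCLike.re (inner ℂ (cfc (fun t => f t) A x) x)
      map_add' := fun f g => by
        have : cfc (fun t => (f + g) t) A = cfc (fun t => f t) A + cfc (fun t => g t) A := by
          simpa using cfc_add (a := A) (fun t => f t) (fun t => g t)
            f.continuous.continuousOn g.continuous.continuousOn
        rw [this, add_apply, inner_add_left, map_add]
      map_smul' := fun r f => by
        have : cfc (fun t => (r • f) t) A = r • cfc (fun t => f t) A := by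
          simpa using cfc_smul r (fun t => f t) A f.continuous.continuousOn
        rw [this, smul_apply, RCLike.real_smul_eq_coe_smul (K := ℂ),
          inner_smul_left]
        simp }
    (fun f hf => by
      have h : (0 : E →L[ℂ] E) ≤ cfc (fun t => f t) A := cfc_nonneg (fun t _ => hf t)
      exact ((ContinuousLinearMap.nonneg_iff_isPositive _).1 h).re_inner_nonneg_left x)

/-- The scalar spectral measure `Δ ↦ ⟨E_A(Δ) x, x⟩` of `A` at the vector `x`: the regular Borel
measure `μ` on `ℝ` with `∫ f dμ = ⟨f(A) x, x⟩` for all `f ∈ C_c(ℝ)`. -/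
def spectralMeasureAt (A : E →L[ℂ] E) (x : E) : Measure ℝ :=
  RealRMK.rieszMeasure (spectralFunctional A x)

instance spectralMeasureAt_regular (A : E →L[ℂ] E) (x : E) :
    (spectralMeasureAt A x).Regular := by
  unfold spectralMeasureAt; infer_instance

theorem integral_spectralMeasureAt (A : E →L[ℂ] E) (x : E) (f : C_c(ℝ, ℝ)) :
    ∫ t, f t ∂(spectralMeasureAt A x) = RCLike.re (inner ℂ (cfc (fun t => f t) A x) x) :=
  RealRMK.integral_rieszMeasure (spectralFunctional A x) f

theorem measure_le_of_compactlySupported {μ ν : Measure ℝ} [μ.Regular] [ν.Regular]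
    (h : ∀ f : C_c(ℝ, ℝ), 0 ≤ f → ∫ x, f x ∂μ ≤ ∫ x, f x ∂ν) : μ ≤ ν := by
  have hK : ∀ K : Set ℝ, IsCompact K → μ K ≤ ν K := by
    intro K hK
    refine ENNReal.le_of_forall_pos_le_add fun ε hε hν => ?_
    obtain ⟨V, hKV, hV, hVν⟩ : ∃ V ⊇ K, IsOpen V ∧ ν V ≤ ν K + ε :=
      hK.exists_isOpen_lt_add (μ := ν) (ENNReal.coe_pos.2 hε).ne' |>.imp
        fun V hV => ⟨hV.1, hV.2.1, hV.2.2.le⟩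
    obtain ⟨f, hf1, hf2, hf3⟩ := exists_continuousMap_one_of_isCompact_subset_isOpen hK hV hKV
    let g : C_c(ℝ, ℝ) := ⟨f, hasCompactSupport_def.mpr hf2⟩
    have h1 := h g (fun x => (hf3.2 x).1)
    have hfin : ν V < ⊤ := hVν.trans_lt (by finiteness)
    have a : μ K ≤ ENNReal.ofReal (∫ x, g x ∂μ) := by
      rw [ofReal_integral_eq_lintegral_ofReal g.integrable
        (Filter.Eventually.of_forall fun x => (hf3.2 x).1)]
      calc μ K = ∫⁻ x, K.indicator 1 x ∂μ := (lintegral_indicator_one hK.measurableSet).symm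
        _ ≤ _ := lintegral_mono fun x => by
          by_cases hx : x ∈ K
          · have : g x = 1 := hf1 hx
            simp [hx, this]
          · simp [hx]
    have b : ENNReal.ofReal (∫ x, g x ∂ν) ≤ ν V := by
      rw [ofReal_integral_eq_lintegral_ofReal g.integrable
        (Filter.Eventually.of_forall fun x => (hf3.2 x).1)]
      calc _ ≤ ∫⁻ x, V.indicator 1 x ∂ν := lintegral_mono fun x => by
            by_cases hx : x ∈ V
            · have : g x ≤ 1 := (hf3.2 x).2
              simpa [hx] using this
            · have : g x = 0 := by
                by_contra h0
                exact hx (hf3.1 (subset_tsupport _ h0))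
              simp [this]
        _ = ν V := lintegral_indicator_one hV.measurableSet
    exact a.trans ((ENNReal.ofReal_le_ofReal h1).trans (b.trans hVν))
  have hU : ∀ U : Set ℝ, IsOpen U → μ U ≤ ν U := fun U hU => by
    rw [hU.measure_eq_iSup_isCompact]
    exact iSup₂_le fun K hKU => iSup_le fun hKc => (hK K hKc).trans (measure_mono hKU)
  refine Measure.le_iff'.2 fun s => ?_
  rw [s.measure_eq_iInf_isOpen ν]
  exact le_iInf₂ fun U hsU => le_iInf fun hUo => (measure_mono hsU).trans (hU U hUo)

theorem spectralMeasureAt_univ_le (A : E →L[ℂ] E) (x : E) (s : Set ℝ) :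
    spectralMeasureAt A x s ≤ ENNReal.ofReal (‖x‖ ^ 2) := by
  refine (measure_mono (Set.subset_univ s)).trans ?_
  rw [isOpen_univ.measure_eq_iSup_isCompact]
  refine iSup₂_le fun K _ => iSup_le fun hK => ?_
  obtain ⟨f, hf1, hf2, hf3⟩ :=
    exists_continuousMap_one_of_isCompact_subset_isOpen hK isOpen_univ (Set.subset_univ K)
  let g : C_c(ℝ, ℝ) := ⟨f, hasCompactSupport_def.mpr hf2⟩
  refine (RealRMK.rieszMeasure_le_of_eq_one (spectralFunctional A x) (f := g)
    (fun t => (hf3.2 t).1) hK (fun t ht => hf1 ht)).trans (ENNReal.ofReal_le_ofReal ?_)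
  change RCLike.re (inner ℂ (cfc (fun t => g t) A x) x) ≤ ‖x‖ ^ 2
  have hn : ‖cfc (fun t => g t) A‖ ≤ 1 :=
    norm_cfc_le zero_le_one fun t _ => by
      have h0 : 0 ≤ g t := (hf3.2 t).1
      have h1 : g t ≤ 1 := (hf3.2 t).2
      rw [Real.norm_of_nonneg h0]; exact h1
  calc _ ≤ ‖inner ℂ (cfc (fun t => g t) A x) x‖ := RCLike.re_le_norm _
    _ ≤ ‖cfc (fun t => g t) A x‖ * ‖x‖ := norm_inner_le_norm _ _
    _ ≤ (1 * ‖x‖) * ‖x‖ := by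
      gcongr
      exact (le_opNorm _ _).trans (by gcongr)
    _ = ‖x‖ ^ 2 := by ring

instance spectralMeasureAt_finite (A : E →L[ℂ] E) (x : E) :
    IsFiniteMeasure (spectralMeasureAt A x) :=
  ⟨(spectralMeasureAt_univ_le A x _).trans_lt ENNReal.ofReal_lt_top⟩

theorem spectralMeasureAt_add_le (A : E →L[ℂ] E) (x y : E) :
    spectralMeasureAt A (x + y) ≤
      (2 : NNReal) • spectralMeasureAt A x + (2 : NNReal) • spectralMeasureAt A y := by
  have : ((2 : NNReal) • spectralMeasureAt A x + (2 : NNReal) • spectralMeasureAt A y).Regular :=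
    inferInstance
  refine measure_le_of_compactlySupported fun f hf => ?_
  have hi : ∀ z, Integrable f (spectralMeasureAt A z) := fun z => f.integrable
  rw [integral_add_measure ((hi x).smul_measure_nnreal) ((hi y).smul_measure_nnreal),
    integral_smul_nnreal_measure, integral_smul_nnreal_measure]
  simp only [integral_spectralMeasureAt]
  have h : (0 : E →L[ℂ] E) ≤ cfc (fun t => f t) A := cfc_nonneg (fun t _ => hf t)
  have h0 := ((ContinuousLinearMap.nonneg_iff_isPositive _).1 h).re_inner_nonneg_left (x - y)
  simp only [map_add, map_sub, inner_add_left, inner_add_right, inner_sub_left,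
    inner_sub_right, NNReal.smul_def, smul_eq_mul, NNReal.coe_ofNat] at h0 ⊢
  linarith

theorem spectralMeasureAt_smul_le (A : E →L[ℂ] E) (c : ℂ) (x : E) :
    spectralMeasureAt A (c • x) ≤ (‖c‖₊ ^ 2 : NNReal) • spectralMeasureAt A x := by
  refine measure_le_of_compactlySupported fun f hf => le_of_eq ?_
  rw [integral_smul_nnreal_measure]
  simp only [integral_spectralMeasureAt, map_smul, inner_smul_left, inner_smul_right,
    NNReal.smul_def, smul_eq_mul]
  rw [← mul_assoc, mul_comm c, RCLike.conj_mul]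
  simp [← Complex.ofReal_pow]

theorem spectralMeasureAt_apply_le (A : E →L[ℂ] E) (hA : IsSelfAdjoint A) (x : E) :
    spectralMeasureAt A (A x) ≤ (‖A‖₊ ^ 2 : NNReal) • spectralMeasureAt A x := by
  refine measure_le_of_compactlySupported fun f hf => ?_
  rw [integral_smul_nnreal_measure]
  simp only [integral_spectralMeasureAt]
  set C := cfc (fun t => f t) A with hC
  have h : (0 : E →L[ℂ] E) ≤ C := cfc_nonneg (fun t _ => hf t)
  set R := CFC.sqrt C with hR
  have hRR : R * R = C := CFC.sqrt_mul_sqrt_self C h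
  have hRs : IsSelfAdjoint R := IsSelfAdjoint.of_nonneg (CFC.sqrt_nonneg C)
  have hCA : Commute C A := IsSelfAdjoint.commute_cfc hA (Commute.refl A) _
  have hRA : Commute R A := by
    rw [hR, CFC.sqrt_eq_real_sqrt C h]
    first
      | exact (hCA.symm.cfcₙ_real _).symm
      | exact hCA.cfcₙ_real _
  have key : ∀ z : E, RCLike.re (inner ℂ (C z) z) = ‖R z‖ ^ 2 := fun z => by
    rw [← hRR, mul_apply_eq_comp]
    rw [← ContinuousLinearMap.adjoint_inner_right, ← ContinuousLinearMap.star_eq_adjoint,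
      hRs.star_eq, inner_self_eq_norm_sq]
  rw [key, key]
  have hsw : R (A x) = A (R x) := by
    have := congrArg (fun T : E →L[ℂ] E => T x) hRA.eq
    simpa using this
  rw [hsw]
  have := A.le_opNorm (R x)
  simp only [NNReal.smul_def, NNReal.coe_pow, coe_nnnorm, smul_eq_mul, ← mul_pow]
  gcongr

/-- The spectral subspace `E_A(Δ)` of a self-adjoint operator `A` for a Borel set `Δ ⊆ ℝ`, that is,
the range of the spectral projection `E_A(Δ)`: the vectors `x` whose spectral measure
`⟨E_A(·) x, x⟩` vanishes on the complement of `Δ`. -/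
def spectralSubspace (A : E →L[ℂ] E) (Δ : Set ℝ) : Submodule ℂ E where
  carrier := {x | spectralMeasureAt A x Δᶜ = 0}
  zero_mem' := by
    have := spectralMeasureAt_univ_le A 0 Δᶜ
    simpa using this
  add_mem' := fun {x y} hx hy => by
    have := spectralMeasureAt_add_le A x y Δᶜ
    simp only [Set.mem_ofPred_eq] at hx hy ⊢
    simpa [hx, hy] using this
  smul_mem' := fun c x hx => by
    have := spectralMeasureAt_smul_le A c x Δᶜ
    simp only [Set.mem_ofPred_eq] at hx ⊢
    simpa [hx] using this

theorem isClosed_spectralSubspace (A : E →L[ℂ] E) (Δ : Set ℝ) :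
    IsClosed (spectralSubspace A Δ : Set E) := by
  refine isClosed_of_closure_subset fun x hx => ?_
  change spectralMeasureAt A x Δᶜ = 0
  refine le_antisymm (le_of_forall_pos_le_add fun ε hε => ?_) bot_le
  rw [zero_add]
  obtain ⟨u, hu, hlim⟩ := mem_closure_iff_seq_limit.1 hx
  have hb : ∀ n, spectralMeasureAt A x Δᶜ ≤ 2 * ENNReal.ofReal (‖x - u n‖ ^ 2) := fun n => by
    have h1 := spectralMeasureAt_add_le A (x - u n) (u n) Δᶜ
    have h2 : spectralMeasureAt A (u n) Δᶜ = 0 := hu n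
    rw [sub_add_cancel] at h1
    refine h1.trans ?_
    simp only [Measure.add_apply, Measure.smul_apply, h2, smul_zero, add_zero]
    change (2 : ℝ≥0∞) * _ ≤ _
    gcongr
    exact spectralMeasureAt_univ_le A _ _
  have hl : Filter.Tendsto (fun n => 2 * ENNReal.ofReal (‖x - u n‖ ^ 2)) Filter.atTop
      (nhds (2 * ENNReal.ofReal (‖x - x‖ ^ 2))) :=
    ENNReal.Tendsto.const_mul
      (ENNReal.tendsto_ofReal ((tendsto_const_nhds.sub hlim).norm.pow 2)) (Or.inr (by simp))
  have := ge_of_tendsto' hl hb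
  simp only [sub_self, norm_zero, ne_eq, OfNat.ofNat_ne_zero, not_false_eq_true, zero_pow,
    ENNReal.ofReal_zero, mul_zero] at this
  exact this.trans bot_le

instance completeSpace_spectralSubspace (A : E →L[ℂ] E) (Δ : Set ℝ) :
    CompleteSpace (spectralSubspace A Δ) :=
  (isClosed_spectralSubspace A Δ).completeSpace_coe

/-- Spectral subspaces are invariant. -/
theorem apply_mem_spectralSubspace (A : E →L[ℂ] E) (hA : IsSelfAdjoint A) (Δ : Set ℝ) :
    ∀ x ∈ spectralSubspace A Δ, A x ∈ spectralSubspace A Δ := fun x hx => by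
  have h := spectralMeasureAt_apply_le A hA x Δᶜ
  change spectralMeasureAt A x Δᶜ = 0 at hx
  change spectralMeasureAt A (A x) Δᶜ = 0
  simpa [hx] using h

end Spectral

/-! ### Polar decomposition and the splitting it induces -/

section Polar

variable {E F : Type*} [NormedAddCommGroup E] [InnerProductSpace ℂ E] [CompleteSpace E]
  [NormedAddCommGroup F] [InnerProductSpace ℂ F] [CompleteSpace F]

theorem opSqrt_isSelfAdjoint (A : E →L[ℂ] E) : IsSelfAdjoint (opSqrt A) :=
  IsSelfAdjoint.of_nonneg (CFC.sqrt_nonneg A)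

theorem mul_adjoint_nonneg (C : F →L[ℂ] E) : 0 ≤ C ∘L C† :=
  (ContinuousLinearMap.nonneg_iff_isPositive _).2
    (ContinuousLinearMap.isPositive_self_comp_adjoint C)

theorem norm_opSqrt_mul_adjoint (C : F →L[ℂ] E) (x : E) :
    ‖(C†) x‖ = ‖opSqrt (C ∘L C†) x‖ := by
  set R := opSqrt (C ∘L C†) with hR
  have hRR : R * R = C ∘L C† := CFC.sqrt_mul_sqrt_self _ (mul_adjoint_nonneg C)
  have hRs : R† = R := opSqrt_isSelfAdjoint _
  have h1 : inner ℂ (R x) (R x) = inner ℂ ((C†) x) ((C†) x) := by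
    rw [ContinuousLinearMap.adjoint_inner_left]
    change _ = inner ℂ x ((C ∘L C†) x)
    rw [← hRR, mul_apply_eq_comp]
    conv_lhs => rw [← hRs, ContinuousLinearMap.adjoint_inner_left, hRs]
  rw [inner_self_eq_norm_sq_to_K, inner_self_eq_norm_sq_to_K] at h1
  have h2 : ‖R x‖ ^ 2 = ‖(C†) x‖ ^ 2 := by exact_mod_cast h1
  exact ((sq_eq_sq₀ (norm_nonneg _) (norm_nonneg _)).1 h2).symm

theorem denseRange_of_adjoint_injective (C : E →L[ℂ] F) (h : Function.Injective (C†)) :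
    DenseRange C := by
  have h1 : C.rangeᗮ = ⊥ := by
    rw [C.orthogonal_range]
    exact LinearMap.ker_eq_bot.2 h
  have h2 := (Submodule.topologicalClosure_eq_top_iff (K := C.range)).2 h1
  exact (Submodule.dense_iff_topologicalClosure_eq_top (s := C.range)).2 h2

theorem denseRange_opSqrt (C : F →L[ℂ] E) (h : Function.Injective (C†)) :
    DenseRange (opSqrt (C ∘L C†)) := by
  refine denseRange_of_adjoint_injective _ ?_
  have hRs : (opSqrt (C ∘L C†))† = opSqrt (C ∘L C†) := opSqrt_isSelfAdjoint _
  rw [hRs, injective_iff_map_eq_zero]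
  intro x hx
  have h' := norm_opSqrt_mul_adjoint C x
  rw [hx, norm_zero, norm_eq_zero] at h'
  exact (injective_iff_map_eq_zero _).1 h x h'

/-- For `C : F → E` injective with injective adjoint (that is, with dense range), the unitary
`V : E → F` in the polar decomposition `C* = V (C C*)^{1/2}`. -/
def polarUnitary (C : F →L[ℂ] E) (h : Function.Injective C) (h' : Function.Injective (C†)) :
    E ≃ₗᵢ[ℂ] F :=
  (LinearEquiv.refl ℂ E).extendOfIsometry (opSqrt (C ∘L C†)).toLinearMap (C†).toLinearMap
    (denseRange_opSqrt C h')
    (denseRange_of_adjoint_injective _ (by rwa [ContinuousLinearMap.adjoint_adjoint]))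
    (norm_opSqrt_mul_adjoint C)

/-- The polar decomposition `C* = V (C C*)^{1/2}`, which determines `V`. -/
theorem polarUnitary_apply (C : F →L[ℂ] E) (h : Function.Injective C)
    (h' : Function.Injective (C†)) (x : E) :
    polarUnitary C h h' (opSqrt (C ∘L C†) x) = (C†) x :=
  LinearEquiv.extendOfIsometry_eq _ _ _ (denseRange_opSqrt C h') _
    (norm_opSqrt_mul_adjoint C) x

instance completeSpace_map (V : E ≃ₗᵢ[ℂ] F) (p : Submodule ℂ E) [CompleteSpace p] :
    CompleteSpace (p.map (V : E →ₗ[ℂ] F)) :=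
  (completeSpace_congr (e := (V.submoduleMap p).toEquiv)
    (V.submoduleMap p).isometry.isUniformEmbedding).1 inferInstance

/-- The restriction of a self-adjoint operator `A` to its spectral subspace `E_A(Δ)`. -/
def spectralPart (A : E →L[ℂ] E) (hA : IsSelfAdjoint A) (Δ : Set ℝ) :
    spectralSubspace A Δ →L[ℂ] spectralSubspace A Δ :=
  A.restrict (apply_mem_spectralSubspace A hA Δ)

/-- For a self-adjoint `A` on `E` and a unitary `V : E → F`: the operator from `V E_A(Δ)` to
`E_A(Δ)` whose adjoint is `V' (A|_{E_A(Δ)})^{1/2}`, where `V' : E_A(Δ) → V E_A(Δ)` is the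
restriction of `V`. -/
def polarPart (A : E →L[ℂ] E) (hA : IsSelfAdjoint A) (V : E ≃ₗᵢ[ℂ] F) (Δ : Set ℝ) :
    (spectralSubspace A Δ).map (V : E →ₗ[ℂ] F) →L[ℂ] spectralSubspace A Δ :=
  ContinuousLinearMap.adjoint
    ((V.submoduleMap (spectralSubspace A Δ)).toContinuousLinearEquiv.toContinuousLinearMap ∘L
      opSqrt (spectralPart A hA Δ))

end Polar

/-! ### The reduced operator `B~` and its parts -/

section Reduced

set_option linter.unusedSectionVars false

variable {H K : Type*} [NormedAddCommGroup H] [InnerProductSpace ℂ H] [CompleteSpace H]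
  [NormedAddCommGroup K] [InnerProductSpace ℂ K] [CompleteSpace K]

/-- The closure of the range of `B`, a closed subspace of `H`. -/
abbrev rangeClosure (B : K →L[ℂ] H) : Submodule ℂ H := B.range.topologicalClosure

/-- `N(B)^⊥`, a closed subspace of `K`. -/
abbrev kerPerp (B : K →L[ℂ] H) : Submodule ℂ K := B.kerᗮ

instance completeSpace_rangeClosure (B : K →L[ℂ] H) : CompleteSpace (rangeClosure B) :=
  (Submodule.isClosed_topologicalClosure _).completeSpace_coe

/-- The reduced operator `B~ : N(B)^⊥ → closure of R(B)`, the restriction of `B`. -/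
def reducedOp (B : K →L[ℂ] H) : kerPerp B →L[ℂ] rangeClosure B :=
  B.restrict fun x _ => Submodule.le_topologicalClosure _ (LinearMap.mem_range_self _ x)

theorem reducedOp_injective (B : K →L[ℂ] H) : Function.Injective (reducedOp B) := by
  rw [injective_iff_map_eq_zero]
  rintro ⟨x, hx⟩ h
  have h1 : B x = 0 := congrArg Subtype.val h
  have h2 : x ∈ B.ker := h1
  have := Submodule.inner_right_of_mem_orthogonal h2 hx
  exact Subtype.ext (inner_self_eq_zero.1 this)

theorem reducedOp_adjoint_injective (B : K →L[ℂ] H) :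
    Function.Injective ((reducedOp B)†) := by
  rw [injective_iff_map_eq_zero]
  intro y hy
  have h1 : ∀ x : K, inner ℂ (B x) (y : H) = 0 := fun x => by
    have : CompleteSpace B.ker := B.isClosed_ker.completeSpace_coe
    obtain ⟨n, hn, p, hp, rfl⟩ := B.ker.exists_add_mem_mem_orthogonal x
    have hn' : B n = 0 := hn
    rw [map_add, hn', zero_add]
    have : inner ℂ (reducedOp B ⟨p, hp⟩) y = 0 := by
      rw [← ContinuousLinearMap.adjoint_inner_right, hy, inner_zero_right]
    exact this
  have h2 : (y : H) ∈ (rangeClosure B)ᗮ := by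
    rw [Submodule.orthogonal_closure, Submodule.mem_orthogonal]
    rintro _ ⟨x, rfl⟩
    exact h1 x
  have := Submodule.inner_right_of_mem_orthogonal y.2 h2
  exact Subtype.ext (inner_self_eq_zero.1 this)

/-- The positive operator `B~ B~*` on the closure of `R(B)`. -/
def reducedSq (B : K →L[ℂ] H) : rangeClosure B →L[ℂ] rangeClosure B :=
  reducedOp B ∘L (reducedOp B)†

theorem reducedSq_isSelfAdjoint (B : K →L[ℂ] H) : IsSelfAdjoint (reducedSq B) :=
  IsSelfAdjoint.of_nonneg (mul_adjoint_nonneg (reducedOp B))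

/-- The unitary `V~` from the closure of `R(B)` onto `N(B)^⊥` in the polar decomposition
`B~* = V~ (B~ B~*)^{1/2}`. -/
def reducedPolar (B : K →L[ℂ] H) : rangeClosure B ≃ₗᵢ[ℂ] kerPerp B :=
  polarUnitary (reducedOp B) (reducedOp_injective B) (reducedOp_adjoint_injective B)

/-- The spectral subspace `E_{B~B~*}(Δ)` of the closure of `R(B)`. -/
def specH (B : K →L[ℂ] H) (Δ : Set ℝ) : Submodule ℂ (rangeClosure B) :=
  spectralSubspace (reducedSq B) Δ

/-- The subspace `V~ E_{B~B~*}(Δ)` of `N(B)^⊥`. -/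
def specK (B : K →L[ℂ] H) (Δ : Set ℝ) : Submodule ℂ (kerPerp B) :=
  (specH B Δ).map (reducedPolar B : rangeClosure B →ₗ[ℂ] kerPerp B)

instance completeSpace_specH (B : K →L[ℂ] H) (Δ : Set ℝ) : CompleteSpace (specH B Δ) :=
  completeSpace_spectralSubspace _ _

instance completeSpace_specK (B : K →L[ℂ] H) (Δ : Set ℝ) : CompleteSpace (specK B Δ) :=
  have : CompleteSpace (specH B Δ) := inferInstance
  completeSpace_map (reducedPolar B) (specH B Δ)

/-- The part of `B~` from `V~ E_{B~B~*}(Δ)` to `E_{B~B~*}(Δ)`: the operator whose adjoint is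
`V~ (B~B~*)^{1/2}` restricted to `E_{B~B~*}(Δ)`. -/
def opPart (B : K →L[ℂ] H) (Δ : Set ℝ) : specK B Δ →L[ℂ] specH B Δ :=
  polarPart (reducedSq B) (reducedSq_isSelfAdjoint B) (reducedPolar B) Δ

end Reduced

end

/-! ### Algebra and positivity of block operators. -/

section BlockAlgebra

variable {E F : Type*} [NormedAddCommGroup E] [InnerProductSpace ℂ E]
  [NormedAddCommGroup F] [InnerProductSpace ℂ F]

/-! Since Q is self-adjoint, |Q| is the only nonnegative P with P² = Q² (`opAbs_eq_of_mul_self`), so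
each formula is checked by squaring a candidate and proving it nonnegative. If both scalars vanish,
Q² is the block-diagonal operator BB* ⊕ B*B.

Two quadratic identities drive the other cases. The square of 2Q - (lam + mu) is D² with D = T ⊕ S,
and Q² - (lam + mu)Q is the block-diagonal operator (CC* - lam mu) ⊕ (C*C - lam mu). By the first, D
commutes with Q, and D⁻¹Q(2Q - (lam + mu)) squares to Q² when D is invertible. By the second, Q(2Q -
(lam + mu)) is Q² plus a nonnegative operator when CC* and C*C are bounded below by lam mu. This is
`opAbs_Qop_eq_highBlock`; it gives at once all cases where lam mu ≤ 0 and the scalars are not both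
zero. At the other extreme, if ‖C‖² ≤ lam mu, completing the square shows that Q is semidefinite, so
|Q| = ±Q (`opAbs_Qop_of_norm_le`).

When 0 < lam mu < ‖B‖², the spectral subspaces of B~B~* below and above c = lam mu separate these
two regimes. They are the kernel of (B~B~* - c)₊ and its orthogonal complement
(`spectralSubspace_Icc_eq`, `spectralSubspace_Ioc_eq`). The polar decomposition carries the
splitting over to N(B)^⊥, so Q becomes a direct sum (`Qop_splitSum`), and absolute values are
compatible with direct sums and unitaries (`opAbs_apply_of_intertwining`). -/

theorem blockOp_toLp (a : E →L[ℂ] E) (b : F →L[ℂ] E) (c : E →L[ℂ] F) (d : F →L[ℂ] F)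
    (x : E) (y : F) :
    blockOp a b c d (WithLp.toLp 2 (x, y)) = WithLp.toLp 2 (a x + b y, c x + d y) := rfl

theorem blockOp_ext {A A' : WithLp 2 (E × F) →L[ℂ] WithLp 2 (E × F)}
    (h : ∀ x y, A (WithLp.toLp 2 (x, y)) = A' (WithLp.toLp 2 (x, y))) : A = A' :=
  ContinuousLinearMap.ext fun z => h z.fst z.snd

theorem blockOp_mul (a a' : E →L[ℂ] E) (b b' : F →L[ℂ] E) (c c' : E →L[ℂ] F) (d d' : F →L[ℂ] F) :
    blockOp a b c d * blockOp a' b' c' d' =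
      blockOp (a ∘L a' + b ∘L c') (a ∘L b' + b ∘L d') (c ∘L a' + d ∘L c')
        (c ∘L b' + d ∘L d') := by
  refine blockOp_ext fun x y => ?_
  simp only [mul_apply_eq_comp, blockOp_toLp, map_add, add_apply, comp_apply]
  congr 2 <;> abel

theorem blockOp_smul (r : ℂ) (a : E →L[ℂ] E) (b : F →L[ℂ] E) (c : E →L[ℂ] F) (d : F →L[ℂ] F) :
    r • blockOp a b c d = blockOp (r • a) (r • b) (r • c) (r • d) := by
  refine blockOp_ext fun x y => ?_
  simp only [blockOp_toLp, smul_apply, ← WithLp.toLp_smul, Prod.smul_mk, smul_add]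

theorem blockOp_one : blockOp (1 : E →L[ℂ] E) 0 0 (1 : F →L[ℂ] F) = 1 :=
  blockOp_ext fun x y => by simp [blockOp_toLp]

theorem directSumOp_mul (a a' : E →L[ℂ] E) (d d' : F →L[ℂ] F) :
    directSumOp a d * directSumOp a' d' = directSumOp (a * a') (d * d') := by
  simp only [directSumOp, blockOp_mul, comp_zero, zero_comp, add_zero, zero_add]
  rfl

theorem ringInverse_apply_apply {T : E →L[ℂ] E} (hT : IsUnit T) (x : E) :
    Ring.inverse T (T x) = x := by
  rw [← mul_apply_eq_comp, Ring.inverse_mul_cancel _ hT, one_apply_eq_self]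

theorem apply_ringInverse_apply {T : E →L[ℂ] E} (hT : IsUnit T) (x : E) :
    T (Ring.inverse T x) = x := by
  rw [← mul_apply_eq_comp, Ring.mul_inverse_cancel _ hT, one_apply_eq_self]

variable [CompleteSpace E] [CompleteSpace F]

theorem blockOp_adjoint (a : E →L[ℂ] E) (b : F →L[ℂ] E) (c : E →L[ℂ] F) (d : F →L[ℂ] F) :
    (blockOp a b c d)† = blockOp (a†) (c†) (b†) (d†) := by
  symm
  rw [ContinuousLinearMap.eq_adjoint_iff]
  rintro z w
  change inner ℂ (blockOp (a†) (c†) (b†) (d†) (WithLp.toLp 2 (z.fst, z.snd)))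
    (WithLp.toLp 2 (w.fst, w.snd)) = inner ℂ (WithLp.toLp 2 (z.fst, z.snd))
      (blockOp a b c d (WithLp.toLp 2 (w.fst, w.snd)))
  simp only [blockOp_toLp, WithLp.prod_inner_apply, inner_add_left, inner_add_right,
    ContinuousLinearMap.adjoint_inner_left]
  ring

/-- With X the direct sum of the two square roots, a ⊕ d is X*X, so no quadratic form has to be
computed. -/
theorem directSumOp_nonneg {a : E →L[ℂ] E} {d : F →L[ℂ] F} (ha : 0 ≤ a) (hd : 0 ≤ d) :
    0 ≤ directSumOp a d := by
  have h : directSumOp a d = star (directSumOp (CFC.sqrt a) (CFC.sqrt d)) *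
      directSumOp (CFC.sqrt a) (CFC.sqrt d) := by
    have h1 : (CFC.sqrt a)† = CFC.sqrt a := IsSelfAdjoint.of_nonneg (CFC.sqrt_nonneg a)
    have h2 : (CFC.sqrt d)† = CFC.sqrt d := IsSelfAdjoint.of_nonneg (CFC.sqrt_nonneg d)
    have h3 : star (directSumOp (CFC.sqrt a) (CFC.sqrt d)) =
        directSumOp (CFC.sqrt a) (CFC.sqrt d) := by
      rw [ContinuousLinearMap.star_eq_adjoint, directSumOp, blockOp_adjoint, h1, h2, map_zero,
        map_zero]
    rw [h3, directSumOp_mul, CFC.sqrt_mul_sqrt_self a ha, CFC.sqrt_mul_sqrt_self d hd]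
  rw [h]
  exact star_mul_self_nonneg _

theorem ofReal_smul_one_adjoint (r : ℝ) : ((r : ℂ) • (1 : E →L[ℂ] E))† = (r : ℂ) • 1 := by
  rw [← ContinuousLinearMap.star_eq_adjoint, star_smul, star_one]; simp

theorem Qop_isSelfAdjoint (lam mu : ℝ) (B : F →L[ℂ] E) : IsSelfAdjoint (Qop lam mu B) := by
  change (Qop lam mu B)† = _
  rw [Qop, blockOp_adjoint, ofReal_smul_one_adjoint, ofReal_smul_one_adjoint,
    ContinuousLinearMap.adjoint_adjoint]

/-! ### Uniqueness of positive square roots and its first consequences. -/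

theorem opSqrt_eq_of_mul_self {A P : E →L[ℂ] E} (hP : 0 ≤ P) (h : P * P = A) : opSqrt A = P :=
  CFC.sqrt_unique h hP

/-- For self-adjoint `A`, A*A is `A * A`, and a positive square root is unique. Every formula for
|Q| is verified through this criterion. -/
theorem opAbs_eq_of_mul_self {A P : E →L[ℂ] E} (hA : IsSelfAdjoint A) (hP : 0 ≤ P)
    (h : P * P = A * A) : opAbs A = P := by
  refine opSqrt_eq_of_mul_self hP ?_
  have : A† = A := hA
  rw [this]; exact h

theorem smul_one_nonneg {r : ℝ} (hr : 0 ≤ r) : (0 : E →L[ℂ] E) ≤ (r : ℂ) • 1 := by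
  rw [Complex.coe_smul]
  exact smul_nonneg hr zero_le_one

theorem ofReal_smul_nonneg {r : ℝ} (hr : 0 ≤ r) {A : E →L[ℂ] E} (hA : 0 ≤ A) :
    0 ≤ (r : ℂ) • A := by
  rw [Complex.coe_smul]
  exact smul_nonneg hr hA

theorem ofReal_smul_one_mono {r s : ℝ} (h : r ≤ s) : (r : ℂ) • (1 : E →L[ℂ] E) ≤ (s : ℂ) • 1 := by
  rw [← sub_nonneg, ← sub_smul, ← Complex.ofReal_sub]
  exact smul_one_nonneg (sub_nonneg.2 h)

theorem opAbs_nonneg (A : F →L[ℂ] E) : 0 ≤ opAbs A := CFC.sqrt_nonneg _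

theorem adjoint_comp_nonneg (A : F →L[ℂ] E) : 0 ≤ A† ∘L A := by
  simpa using mul_adjoint_nonneg (A†)

theorem opAbs_mul_self (A : F →L[ℂ] E) : opAbs A * opAbs A = A† ∘L A :=
  CFC.sqrt_mul_sqrt_self _ (adjoint_comp_nonneg A)

theorem opAbs_Qop_mul_self (lam mu : ℝ) (C : F →L[ℂ] E) :
    opAbs (Qop lam mu C) * opAbs (Qop lam mu C) = Qop lam mu C * Qop lam mu C := by
  have : (Qop lam mu C)† = Qop lam mu C := Qop_isSelfAdjoint lam mu C
  rw [opAbs_mul_self, this]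
  rfl

/-- The diagonal scalars vanish. -/
theorem opAbs_Qop_zero_zero (C : F →L[ℂ] E) :
    opAbs (Qop 0 0 C) = blockOp (opAbs (C†)) 0 0 (opAbs C) := by
  refine opAbs_eq_of_mul_self (Qop_isSelfAdjoint _ _ _)
    (directSumOp_nonneg (opAbs_nonneg _) (opAbs_nonneg _)) ?_
  change directSumOp _ _ * directSumOp _ _ = _
  rw [directSumOp_mul, opAbs_mul_self, opAbs_mul_self, ContinuousLinearMap.adjoint_adjoint, Qop,
    blockOp_mul]
  simp [directSumOp]

/-! ### The shifted operator and its absolute value T ⊕ S. -/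

/-- The operator `2 Q - (lam + mu) I`. -/
theorem two_smul_Qop_sub (lam mu : ℝ) (C : F →L[ℂ] E) :
    (2 : ℂ) • Qop lam mu C - ((lam + mu : ℝ) : ℂ) • 1 =
      blockOp (((lam - mu : ℝ) : ℂ) • 1) ((2 : ℂ) • C) ((2 : ℂ) • C†)
        (((mu - lam : ℝ) : ℂ) • 1) := by
  refine blockOp_ext fun x y => ?_
  simp only [Qop, blockOp_toLp, sub_apply, smul_apply, one_apply_eq_self, ← WithLp.toLp_smul,
    ← WithLp.toLp_sub, Prod.smul_mk, Prod.mk_sub_mk]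
  push_cast
  congr 2 <;> module

theorem rootT_mul_self (lam mu : ℝ) (C : F →L[ℂ] E) :
    rootT lam mu C * rootT lam mu C =
      (((mu - lam) ^ 2 : ℝ) : ℂ) • 1 + (4 : ℂ) • (C ∘L C†) :=
  CFC.sqrt_mul_sqrt_self _ (add_nonneg (smul_one_nonneg (sq_nonneg _))
    (by simpa using ofReal_smul_nonneg (r := 4) (by norm_num) (mul_adjoint_nonneg C)))

theorem rootS_mul_self (lam mu : ℝ) (C : F →L[ℂ] E) :
    rootS lam mu C * rootS lam mu C =
      (((mu - lam) ^ 2 : ℝ) : ℂ) • 1 + (4 : ℂ) • (C† ∘L C) :=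
  CFC.sqrt_mul_sqrt_self _ (add_nonneg (smul_one_nonneg (sq_nonneg _))
    (by simpa using ofReal_smul_nonneg (r := 4) (by norm_num) (adjoint_comp_nonneg C)))

theorem rootT_nonneg (lam mu : ℝ) (C : F →L[ℂ] E) : 0 ≤ rootT lam mu C := CFC.sqrt_nonneg _

theorem rootS_nonneg (lam mu : ℝ) (C : F →L[ℂ] E) : 0 ≤ rootS lam mu C := CFC.sqrt_nonneg _

/-- The shift makes the two diagonal scalars opposite, so the off-diagonal entries of the square
cancel. This is the origin of T and S. -/
theorem two_smul_Qop_sub_mul_self (lam mu : ℝ) (C : F →L[ℂ] E) :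
    ((2 : ℂ) • Qop lam mu C - ((lam + mu : ℝ) : ℂ) • 1) *
      ((2 : ℂ) • Qop lam mu C - ((lam + mu : ℝ) : ℂ) • 1) =
    directSumOp (rootT lam mu C) (rootS lam mu C) *
      directSumOp (rootT lam mu C) (rootS lam mu C) := by
  rw [two_smul_Qop_sub, directSumOp_mul, rootT_mul_self, rootS_mul_self, directSumOp, blockOp_mul]
  refine blockOp_ext fun x y => ?_
  simp only [blockOp_toLp, add_apply, comp_apply, smul_apply, one_apply_eq_self, map_smul,
    zero_apply]
  push_cast
  congr 2 <;> module

/-- `D` is the positive square root of `A * A`, hence a function of an operator that commutes with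
`A`. -/
theorem commute_opSqrt_mul_self {A : E →L[ℂ] E} {D : E →L[ℂ] E} (hD : 0 ≤ D)
    (h : A * A = D * D) : Commute D A := by
  have h1 : D = CFC.sqrt (A * A) := (CFC.sqrt_unique h.symm hD).symm
  have h0 : 0 ≤ A * A := by
    rw [h]
    exact Commute.mul_nonneg hD hD (Commute.refl D)
  rw [h1, CFC.sqrt_eq_real_sqrt _ h0]
  have h2 : Commute (A * A) A := (Commute.refl A).mul_left (Commute.refl A)
  exact h2.cfcₙ_real _

theorem commute_roots_Qop (lam mu : ℝ) (C : F →L[ℂ] E) :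
    Commute (directSumOp (rootT lam mu C) (rootS lam mu C)) (Qop lam mu C) := by
  have h := commute_opSqrt_mul_self
    (directSumOp_nonneg (rootT_nonneg lam mu C) (rootS_nonneg lam mu C))
    (two_smul_Qop_sub_mul_self lam mu C)
  have h1 : Qop lam mu C = (1 / 2 : ℂ) • (((2 : ℂ) • Qop lam mu C - ((lam + mu : ℝ) : ℂ) • 1) +
      ((lam + mu : ℝ) : ℂ) • 1) := by module
  rw [h1]
  exact (h.add_right ((Commute.one_right _).smul_right _)).smul_right _

/-- The upper right entry of the relation DQ = QD, where D = T ⊕ S. The companion for the adjoint is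
the lower left entry. -/
theorem rootT_apply (lam mu : ℝ) (C : F →L[ℂ] E) (y : F) :
    rootT lam mu C (C y) = C (rootS lam mu C y) := by
  have h := congrArg (fun A => A (WithLp.toLp 2 ((0 : E), y))) (commute_roots_Qop lam mu C).eq
  simp only [mul_apply_eq_comp, Qop, directSumOp, blockOp_toLp, map_zero, zero_add,
    zero_apply, add_zero] at h
  exact congrArg WithLp.fst h

theorem rootS_apply_adjoint (lam mu : ℝ) (C : F →L[ℂ] E) (x : E) :
    rootS lam mu C ((C†) x) = (C†) (rootT lam mu C x) := by
  have h := congrArg (fun A => A (WithLp.toLp 2 (x, (0 : F)))) (commute_roots_Qop lam mu C).eq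
  simp only [mul_apply_eq_comp, Qop, directSumOp, blockOp_toLp, map_zero, zero_add,
    zero_apply, add_zero] at h
  exact congrArg WithLp.snd h

/-- Lets the inverses be moved across C, so that entries written with T⁻¹ and with S⁻¹ can be
compared. -/
theorem ringInverse_rootT_apply {lam mu : ℝ} {C : F →L[ℂ] E} (hT : IsUnit (rootT lam mu C))
    (hS : IsUnit (rootS lam mu C)) (y : F) :
    Ring.inverse (rootT lam mu C) (C y) = C (Ring.inverse (rootS lam mu C) y) := by
  conv_lhs => rw [← apply_ringInverse_apply hS y, ← rootT_apply, ringInverse_apply_apply hT]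

theorem ringInverse_rootS_apply_adjoint {lam mu : ℝ} {C : F →L[ℂ] E}
    (hT : IsUnit (rootT lam mu C)) (hS : IsUnit (rootS lam mu C)) (x : E) :
    Ring.inverse (rootS lam mu C) ((C†) x) = (C†) (Ring.inverse (rootT lam mu C) x) := by
  conv_lhs => rw [← apply_ringInverse_apply hT x, ← rootS_apply_adjoint,
    ringInverse_apply_apply hS]

/-! ### The formula for |Q| when CC* and C*C are bounded below. -/

theorem isUnit_opSqrt_of_le {A : E →L[ℂ] E} {r : ℝ} (hr : 0 < r) (h : (r : ℂ) • 1 ≤ A) :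
    IsUnit (opSqrt A) := by
  have h0 : 0 ≤ A := (smul_one_nonneg hr.le).trans h
  refine (CFC.isUnit_sqrt_iff A h0).2 (CStarAlgebra.isUnit_of_le _ h ?_)
  refine IsStrictlyPositive.iff_of_unital.2 ⟨smul_one_nonneg hr.le, ?_⟩
  rw [← Algebra.algebraMap_eq_smul_one]
  exact (IsUnit.mk0 (r : ℂ) (by exact_mod_cast hr.ne')).map (algebraMap ℂ (E →L[ℂ] E))

theorem smul_add_four_smul_le {c r : ℝ} {A : E →L[ℂ] E} (h : (c : ℂ) • 1 ≤ A) :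
    ((r + 4 * c : ℝ) : ℂ) • 1 ≤ (r : ℂ) • 1 + (4 : ℂ) • A := by
  rw [← sub_nonneg]
  have h1 : (r : ℂ) • 1 + (4 : ℂ) • A - ((r + 4 * c : ℝ) : ℂ) • 1 =
      ((4 : ℝ) : ℂ) • (A - (c : ℂ) • 1) := by
    push_cast; module
  rw [h1]
  exact ofReal_smul_nonneg (by norm_num) (sub_nonneg.2 h)

theorem isUnit_rootT {lam mu c : ℝ} {C : F →L[ℂ] E} (h : (c : ℂ) • 1 ≤ C ∘L C†)
    (hc : 0 < (mu - lam) ^ 2 + 4 * c) : IsUnit (rootT lam mu C) :=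
  isUnit_opSqrt_of_le hc (smul_add_four_smul_le h)

theorem isUnit_rootS {lam mu c : ℝ} {C : F →L[ℂ] E} (h : (c : ℂ) • 1 ≤ C† ∘L C)
    (hc : 0 < (mu - lam) ^ 2 + 4 * c) : IsUnit (rootS lam mu C) :=
  isUnit_opSqrt_of_le hc (smul_add_four_smul_le h)

/-- The matrix of 2Q² - (lam + mu)Q has off-diagonal entries (lam + mu)C and (lam + mu)C*; after
multiplication by T⁻¹ ⊕ S⁻¹ only the side on which the inverse stands remains to be adjusted, by the
intertwining relations. -/
theorem highBlock_eq {lam mu : ℝ} {C : F →L[ℂ] E}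
    (hT : IsUnit (rootT lam mu C)) (hS : IsUnit (rootS lam mu C)) :
    highBlock lam mu C =
      directSumOp (Ring.inverse (rootT lam mu C)) (Ring.inverse (rootS lam mu C)) *
        ((2 : ℂ) • (Qop lam mu C * Qop lam mu C) - ((lam + mu : ℝ) : ℂ) • Qop lam mu C) := by
  refine blockOp_ext fun x y => ?_
  simp only [highBlock, directSumOp, Qop, mul_apply_eq_comp, sub_apply, smul_apply, blockOp_toLp,
    ← WithLp.toLp_smul, ← WithLp.toLp_sub, Prod.smul_mk, Prod.mk_sub_mk, comp_apply, add_apply,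
    one_apply_eq_self, zero_apply, map_add, map_sub, map_smul,
    ringInverse_rootT_apply hT hS, ringInverse_rootS_apply_adjoint hT hS]
  push_cast
  congr 2 <;> module

/-- The formula for `|Q|` when both `C C*` and `C* C` are bounded below by `lam * mu`. -/
theorem opAbs_Qop_eq_highBlock {lam mu c : ℝ} {C : F →L[ℂ] E} (hlm : lam * mu ≤ c)
    (hc : 0 < (mu - lam) ^ 2 + 4 * c) (hE : (c : ℂ) • 1 ≤ C ∘L C†) (hF : (c : ℂ) • 1 ≤ C† ∘L C) :
    opAbs (Qop lam mu C) = highBlock lam mu C := by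
  have hT := isUnit_rootT hE hc
  have hS := isUnit_rootS hF hc
  set Q := Qop lam mu C with hQ
  set D := directSumOp (rootT lam mu C) (rootS lam mu C) with hD
  set D' := directSumOp (Ring.inverse (rootT lam mu C)) (Ring.inverse (rootS lam mu C)) with hD'
  set M := (2 : ℂ) • (Q * Q) - ((lam + mu : ℝ) : ℂ) • Q with hM
  have hDD' : D * D' = 1 := by
    rw [hD, hD', directSumOp_mul, Ring.mul_inverse_cancel _ hT, Ring.mul_inverse_cancel _ hS]
    exact blockOp_one
  have hD'D : D' * D = 1 := by
    rw [hD, hD', directSumOp_mul, Ring.inverse_mul_cancel _ hT, Ring.inverse_mul_cancel _ hS]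
    exact blockOp_one
  have hDQ : Commute D Q := commute_roots_Qop lam mu C
  have hD'Q : Commute D' Q := by
    change D' * Q = Q * D'
    calc D' * Q = D' * (Q * D) * D' := by rw [mul_assoc, mul_assoc, hDD', mul_one]
      _ = Q * D' := by rw [← hDQ.eq, ← mul_assoc, hD'D, one_mul]
  have hD'M : Commute D' M :=
    ((hD'Q.mul_right hD'Q).smul_right _).sub_right (hD'Q.smul_right _)
  have hM0 : 0 ≤ M := by
    -- Here M is Q² + (Q² - (lam + mu)Q), and the bracket is block diagonal: an operator form of the
    -- Cayley–Hamilton identity for a 2 × 2 matrix.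
    have h1 : M = star Q * Q + directSumOp (C ∘L C† - ((lam * mu : ℝ) : ℂ) • 1)
        (C† ∘L C - ((lam * mu : ℝ) : ℂ) • 1) := by
      rw [(Qop_isSelfAdjoint lam mu C).star_eq, hM]
      refine blockOp_ext fun x y => ?_
      simp only [directSumOp, hQ, Qop, mul_apply_eq_comp, sub_apply, smul_apply, blockOp_toLp,
        ← WithLp.toLp_smul, ← WithLp.toLp_sub, ← WithLp.toLp_add, Prod.mk_add_mk, Prod.smul_mk,
        Prod.mk_sub_mk, comp_apply, add_apply, one_apply_eq_self, zero_apply, map_add, map_smul]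
      push_cast
      congr 2 <;> module
    rw [h1]
    exact add_nonneg (star_mul_self_nonneg _) (directSumOp_nonneg
      (sub_nonneg.2 ((ofReal_smul_one_mono hlm).trans hE))
      (sub_nonneg.2 ((ofReal_smul_one_mono hlm).trans hF)))
  -- A product of commuting nonnegative operators is nonnegative.
  have hP0 : 0 ≤ D' * M := Commute.mul_nonneg
    (directSumOp_nonneg
      ((CFC.ringInverse_nonneg_iff_nonneg_of_isUnit hT).2 (rootT_nonneg lam mu C))
      ((CFC.ringInverse_nonneg_iff_nonneg_of_isUnit hS).2 (rootS_nonneg lam mu C))) hM0 hD'M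
  rw [highBlock_eq hT hS]
  refine opAbs_eq_of_mul_self (Qop_isSelfAdjoint _ _ _) hP0 ?_
  -- With M factored this way, M² is D²Q², and the two factors D' cancel D².
  have hMQ : M = Q * ((2 : ℂ) • Q - ((lam + mu : ℝ) : ℂ) • 1) := by
    rw [hM, mul_sub, mul_smul_comm, mul_smul_comm, mul_one]
  have hQR : Commute ((2 : ℂ) • Q - ((lam + mu : ℝ) : ℂ) • 1) Q :=
    ((Commute.refl Q).smul_left _).sub_left ((Commute.one_left Q).smul_left _)
  calc D' * M * (D' * M) = D' * D' * (M * M) := by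
        rw [mul_assoc, ← mul_assoc M, ← hD'M.eq, mul_assoc, mul_assoc]
    _ = D' * D' * ((D * D) * (Q * Q)) := by
        rw [hMQ, hD, ← two_smul_Qop_sub_mul_self, ← hQ]
        congr 1
        rw [hQR.mul_mul_mul_comm, ((hQR.mul_left hQR).mul_right (hQR.mul_left hQR)).eq]
    _ = Q * Q := by
        rw [mul_assoc, mul_assoc, ← mul_assoc D' D, hD'D, one_mul, ← mul_assoc, hD'D, one_mul]

/-! ### The semidefinite regime. -/

/-- If `‖C‖² ≤ lam * mu` then `Q` is semidefinite. -/
theorem smul_Qop_nonneg {lam mu : ℝ} {C : F →L[ℂ] E} (h0 : 0 < lam * mu)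
    (h : ∀ y, ‖C y‖ ^ 2 ≤ lam * mu * ‖y‖ ^ 2) :
    0 ≤ ((|lam| / lam : ℝ) : ℂ) • Qop lam mu C := by
  have hl : lam ≠ 0 := by rintro rfl; simp at h0
  have hla : 0 < |lam| := abs_pos.2 hl
  set s : ℝ := |lam| / lam with hs
  have hs1 : s * lam = |lam| := by rw [hs]; field_simp
  have hs2 : |s| ≤ 1 := by rw [hs, abs_div, abs_abs, div_self hla.ne']
  refine (ContinuousLinearMap.nonneg_iff_isPositive _).2 (isPositive_def'.2 ⟨?_, fun z => ?_⟩)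
  · exact IsSelfAdjoint.smul (Complex.conj_ofReal s) (Qop_isSelfAdjoint lam mu C)
  obtain ⟨x, y, rfl⟩ : ∃ x y, z = WithLp.toLp 2 (x, y) := ⟨z.fst, z.snd, rfl⟩
  have key : reApplyInnerSelf ((s : ℂ) • Qop lam mu C) (WithLp.toLp 2 (x, y)) =
      s * (lam * ‖x‖ ^ 2 + 2 * RCLike.re (inner ℂ (C y) x) + mu * ‖y‖ ^ 2) := by
    rw [reApplyInnerSelf_apply, smul_apply, inner_smul_left, Complex.conj_ofReal, Qop, blockOp_toLp]
    simp only [WithLp.prod_inner_apply, inner_add_left, smul_apply, one_apply_eq_self,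
      inner_smul_left, Complex.conj_ofReal, ContinuousLinearMap.adjoint_inner_left,
      inner_self_eq_norm_sq_to_K]
    rw [← inner_conj_symm x (C y)]
    simp only [RCLike.re_to_complex, Complex.mul_re, Complex.add_re, Complex.ofReal_re,
      Complex.ofReal_im, Complex.conj_re, Complex.coe_algebraMap, ← Complex.ofReal_pow]
    ring
  rw [key]
  have h1 : |RCLike.re (inner ℂ (C y) x)| ≤ ‖C y‖ * ‖x‖ :=
    (RCLike.abs_re_le_norm _).trans (norm_inner_le_norm _ _)
  have h2 : |s * RCLike.re (inner ℂ (C y) x)| ≤ ‖C y‖ * ‖x‖ := by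
    rw [abs_mul]
    exact (mul_le_of_le_one_left (abs_nonneg _) hs2).trans h1
  have h3 := (abs_le.1 h2).1
  have h4 := h y
  -- Multiplying the form by |lam| completes the square: what is left is the norm bound on C and a
  -- Cauchy–Schwarz remainder.
  refine (mul_nonneg_iff_of_pos_left hla).1 ?_
  have e : |lam| * (s * (lam * ‖x‖ ^ 2 + 2 * RCLike.re (inner ℂ (C y) x) + mu * ‖y‖ ^ 2)) =
      (|lam| * ‖x‖ - ‖C y‖) ^ 2 + (lam * mu * ‖y‖ ^ 2 - ‖C y‖ ^ 2) +
        2 * |lam| * (s * RCLike.re (inner ℂ (C y) x) + ‖C y‖ * ‖x‖) := by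
    have e1 : |lam| * (s * mu) = lam * mu := by
      rw [hs, ← mul_assoc, mul_div_assoc', abs_mul_abs_self, mul_div_assoc, div_self hl, mul_one]
    linear_combination (|lam| * ‖x‖ ^ 2) * hs1 + ‖y‖ ^ 2 * e1
  rw [e]
  have h5 := mul_nonneg (mul_nonneg zero_le_two hla.le) (by linarith :
    0 ≤ s * RCLike.re (inner ℂ (C y) x) + ‖C y‖ * ‖x‖)
  have h6 := sq_nonneg (|lam| * ‖x‖ - ‖C y‖)
  linarith

/-- The scalar |lam| / lam is a sign, so multiplying Q by it makes Q nonnegative without changing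
its square. -/
theorem opAbs_Qop_of_norm_le {lam mu : ℝ} {C : F →L[ℂ] E} (h0 : 0 < lam * mu)
    (h : ∀ y, ‖C y‖ ^ 2 ≤ lam * mu * ‖y‖ ^ 2) :
    opAbs (Qop lam mu C) = ((|lam| / lam : ℝ) : ℂ) • Qop lam mu C := by
  refine opAbs_eq_of_mul_self (Qop_isSelfAdjoint _ _ _) (smul_Qop_nonneg h0 h) ?_
  have hl : lam ≠ 0 := by rintro rfl; simp at h0
  have h1 : (|lam| / lam) * (|lam| / lam) = 1 := by
    rw [div_mul_div_comm, abs_mul_abs_self, div_self (mul_ne_zero hl hl)]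
  rw [smul_mul_smul_comm, ← Complex.ofReal_mul, h1, Complex.ofReal_one, one_smul]

theorem opAbs_Qop_eq_lowBlock {lam mu : ℝ} {C : F →L[ℂ] E} (h0 : 0 < lam * mu)
    (h : ∀ y, ‖C y‖ ^ 2 ≤ lam * mu * ‖y‖ ^ 2) :
    opAbs (Qop lam mu C) = ((|lam| : ℝ) : ℂ) • lowBlock lam mu C := by
  rw [opAbs_Qop_of_norm_le h0 h]
  have hl : (lam : ℂ) ≠ 0 := by rintro h; simp at h; simp [h] at h0
  have e1 : ((|lam| : ℝ) : ℂ) / lam * lam = (|lam| : ℝ) := by field_simp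
  have e2 : ((|lam| : ℝ) : ℂ) / lam = (|lam| : ℝ) * (1 / lam) := by field_simp
  have e3 : ((|lam| : ℝ) : ℂ) / lam * mu = (|lam| : ℝ) * (mu / lam) := by field_simp
  rw [Qop, lowBlock, blockOp_smul, blockOp_smul]
  simp only [smul_smul]
  push_cast
  rw [e1, e3, e2]

end BlockAlgebra

/-! ### Spectral measures tested on continuous functions. -/

section SpectralSubspaces

variable {E : Type*} [NormedAddCommGroup E] [InnerProductSpace ℂ E] [CompleteSpace E]
  {A : E →L[ℂ] E}

/-- A bump function equal to 1 on a compact set outside the interval can be chosen to vanish on the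
spectrum, so its functional calculus is zero; inner regularity does the rest. -/
theorem spectralMeasureAt_compl_Icc {a b : ℝ} (hσ : spectrum ℝ A ⊆ Set.Icc a b) (x : E) :
    spectralMeasureAt A x (Set.Icc a b)ᶜ = 0 := by
  have hU : IsOpen (Set.Icc a b)ᶜ := isClosed_Icc.isOpen_compl
  refine le_antisymm ?_ bot_le
  rw [hU.measure_eq_iSup_isCompact]
  refine iSup₂_le fun K hKU => iSup_le fun hK => ?_
  obtain ⟨f, hf1, hf2, hf3⟩ := exists_continuousMap_one_of_isCompact_subset_isOpen hK hU hKU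
  let g : C_c(ℝ, ℝ) := ⟨f, hasCompactSupport_def.mpr hf2⟩
  refine (RealRMK.rieszMeasure_le_of_eq_one (spectralFunctional A x) (f := g)
    (fun t => (hf3.2 t).1) hK (fun t ht => hf1 ht)).trans ?_
  change ENNReal.ofReal (RCLike.re (inner ℂ (cfc (fun t => g t) A x) x)) ≤ 0
  have h0 : cfc (fun t => g t) A = 0 := by
    rw [cfc_congr (g := fun _ => (0 : ℝ)), cfc_const_zero]
    intro t ht
    by_contra h
    exact hf3.1 (subset_tsupport _ h) (hσ ht)
  simp [h0]

theorem exists_compactlySupported_eqOn_Icc {g : ℝ → ℝ} (hg : Continuous g) (a b : ℝ) :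
    ∃ f : C_c(ℝ, ℝ), Set.EqOn f g (Set.Icc a b) := by
  obtain ⟨φ, hφ1, hφ2, -⟩ := exists_continuousMap_one_of_isCompact_subset_isOpen
    (isCompact_Icc (a := a) (b := b)) isOpen_univ (Set.subset_univ _)
  refine ⟨⟨φ * ⟨g, hg⟩, HasCompactSupport.mul_right (hasCompactSupport_def.mpr hφ2)⟩, ?_⟩
  intro t ht
  change φ t * g t = g t
  rw [hφ1 ht, Pi.one_apply, one_mul]

theorem ae_eq_of_eqOn_Icc {a b : ℝ} (hσ : spectrum ℝ A ⊆ Set.Icc a b) (x : E) {f g : ℝ → ℝ}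
    (h : Set.EqOn f g (Set.Icc a b)) : f =ᵐ[spectralMeasureAt A x] g := by
  refine measure_mono_null (fun t ht => ?_) (spectralMeasureAt_compl_Icc hσ x)
  exact fun h' => ht (h h')

theorem integrable_spectralMeasureAt {a b : ℝ} (hσ : spectrum ℝ A ⊆ Set.Icc a b) (x : E)
    {g : ℝ → ℝ} (hg : Continuous g) : Integrable g (spectralMeasureAt A x) := by
  obtain ⟨f, hf⟩ := exists_compactlySupported_eqOn_Icc hg a b
  exact f.integrable.congr (ae_eq_of_eqOn_Icc hσ x hf)

/-- The Riesz measure is only tested on compactly supported functions. Both the measure and the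
spectrum live on `Set.Icc a b`, so `g` may be cut off outside it. This admits the constant 1 and (t
- c)₊. -/
theorem integral_spectralMeasureAt_of_continuous {a b : ℝ} (hσ : spectrum ℝ A ⊆ Set.Icc a b)
    (x : E) {g : ℝ → ℝ} (hg : Continuous g) :
    ∫ t, g t ∂(spectralMeasureAt A x) = RCLike.re (inner ℂ (cfc g A x) x) := by
  obtain ⟨f, hf⟩ := exists_compactlySupported_eqOn_Icc hg a b
  rw [← integral_congr_ae (ae_eq_of_eqOn_Icc hσ x hf), integral_spectralMeasureAt]
  rw [cfc_congr (hf.mono hσ)]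

/-- Integrating the constant 1 shows that the total mass is ‖x‖². -/
theorem eq_zero_of_spectralMeasureAt_univ {a b : ℝ} (hA : IsSelfAdjoint A)
    (hσ : spectrum ℝ A ⊆ Set.Icc a b) {x : E}
    (h : spectralMeasureAt A x Set.univ = 0) : x = 0 := by
  have h1 := integral_spectralMeasureAt_of_continuous hσ x (g := fun _ => 1) continuous_const
  rw [Measure.measure_univ_eq_zero.1 h, cfc_const_one ℝ A, integral_zero_measure,
    one_apply_eq_self, inner_self_eq_norm_sq] at h1
  simpa using h1.symm

/-! ### Cutting the spectrum at c by the positive part. -/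

/-- `(A - c)₊`. -/
noncomputable def posPartAt (A : E →L[ℂ] E) (c : ℝ) : E →L[ℂ] E := cfc (fun t => max (t - c) 0) A

/-- `(A - c)₋`. -/
noncomputable def negPartAt (A : E →L[ℂ] E) (c : ℝ) : E →L[ℂ] E := cfc (fun t => max (c - t) 0) A

theorem posPartAt_nonneg (A : E →L[ℂ] E) (c : ℝ) : 0 ≤ posPartAt A c :=
  cfc_nonneg fun _ _ => le_max_right _ _

theorem negPartAt_nonneg (A : E →L[ℂ] E) (c : ℝ) : 0 ≤ negPartAt A c :=
  cfc_nonneg fun _ _ => le_max_right _ _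

theorem negPartAt_mul_posPartAt (A : E →L[ℂ] E) (c : ℝ) : negPartAt A c * posPartAt A c = 0 := by
  rw [negPartAt, posPartAt, ← cfc_mul _ _ A (by fun_prop) (by fun_prop),
    cfc_congr (g := fun _ => (0 : ℝ)), cfc_const_zero]
  intro t _
  rcases le_total t c with h | h
  · simp [max_eq_right (sub_nonpos.2 h)]
  · simp [max_eq_right (sub_nonpos.2 h)]

theorem posPartAt_sub_negPartAt (hA : IsSelfAdjoint A) (c : ℝ) :
    posPartAt A c - negPartAt A c = A - (c : ℂ) • 1 := by
  rw [negPartAt, posPartAt, ← cfc_sub _ _ A (by fun_prop) (by fun_prop),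
    cfc_congr (g := fun t => t - c), cfc_sub _ _ A (by fun_prop) (by fun_prop), cfc_id' ℝ A,
    cfc_const c A, Algebra.algebraMap_eq_smul_one, Complex.coe_smul]
  intro t _
  rcases le_total t c with h | h
  · simp [max_eq_right (sub_nonpos.2 h), max_eq_left (sub_nonneg.2 h)]
  · simp [max_eq_right (sub_nonpos.2 h), max_eq_left (sub_nonneg.2 h)]

/-- For x in the kernel, (t - c)₊ has integral ⟨(A - c)₊x, x⟩ = 0 against the spectral measure, so
this nonnegative function vanishes almost everywhere. -/
theorem ker_posPartAt_le {c M : ℝ} (hσ : spectrum ℝ A ⊆ Set.Icc 0 M) :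
    (posPartAt A c).ker ≤ spectralSubspace A (Set.Icc 0 c) := by
  intro x hx
  change spectralMeasureAt A x (Set.Icc 0 c)ᶜ = 0
  have hx0 : posPartAt A c x = 0 := hx
  have hg : Continuous fun t : ℝ => max (t - c) 0 := by fun_prop
  have h1 := integral_spectralMeasureAt_of_continuous hσ x hg
  change _ = RCLike.re (inner ℂ (posPartAt A c x) x) at h1
  rw [hx0, inner_zero_left, map_zero,
    integral_eq_zero_iff_of_nonneg (f := fun t => max (t - c) 0) (fun t => le_max_right _ _)
      (integrable_spectralMeasureAt hσ x hg)] at h1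
  refine measure_mono_null (fun t ht => ?_) (measure_union_null (spectralMeasureAt_compl_Icc hσ x) h1)
  by_cases h0 : t ∈ Set.Icc 0 M
  · right
    intro h2
    have h3 : max (t - c) 0 = 0 := h2
    have h4 := le_max_left (t - c) 0
    exact ht ⟨h0.1, by linarith⟩
  · exact Or.inl h0

theorem range_posPartAt_le {c M : ℝ} (hσ : spectrum ℝ A ⊆ Set.Icc 0 M) :
    (posPartAt A c).range ≤ spectralSubspace A (Set.Ioc c M) := by
  rintro _ ⟨y, rfl⟩
  change spectralMeasureAt A (posPartAt A c y) (Set.Ioc c M)ᶜ = 0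
  set x := posPartAt A c y with hx
  suffices h : spectralMeasureAt A x (Set.Iic c) = 0 by
    refine measure_mono_null (fun t ht => ?_)
      (measure_union_null (spectralMeasureAt_compl_Icc hσ x) h)
    by_cases h0 : t ∈ Set.Icc 0 M
    · right
      by_contra h2
      exact ht ⟨not_le.1 h2, h0.2⟩
    · exact Or.inl h0
  -- With g = (t - c)₊ and x = g(A)y, the function f = ε / (ε + g²) is 1 on `Set.Iic c`, while the
  -- integral of f is ⟨(g f g)(A)y, y⟩ and g f g ≤ ε. Letting ε tend to 0 kills the mass.
  have hb : ∀ ε : ℝ, 0 < ε → (spectralMeasureAt A x).real (Set.Iic c) ≤ ε * ‖y‖ ^ 2 := by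
    intro ε hε
    set g : ℝ → ℝ := fun t => max (t - c) 0 with hg
    have hpos : ∀ t, 0 < ε + g t ^ 2 := fun t => by positivity
    set f : ℝ → ℝ := fun t => ε / (ε + g t ^ 2) with hf
    have hgc : Continuous g := by fun_prop
    have hfc : Continuous f := by
      refine continuous_const.div (by fun_prop) fun t => (hpos t).ne'
    have h1 : (spectralMeasureAt A x).real (Set.Iic c) ≤ ∫ t, f t ∂(spectralMeasureAt A x) := by
      rw [← integral_indicator_one measurableSet_Iic]
      refine integral_mono ((integrable_const 1).indicator measurableSet_Iic)
        (integrable_spectralMeasureAt hσ x hfc) fun t => ?_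
      by_cases ht : t ∈ Set.Iic c
      · have : g t = 0 := max_eq_right (sub_nonpos.2 ht)
        simp [ht, hf, this, hε.ne']
      · simp only [Set.indicator_of_notMem ht]
        exact div_nonneg hε.le (hpos t).le
    refine h1.trans ?_
    have hGs : (posPartAt A c)† = posPartAt A c := IsSelfAdjoint.of_nonneg (posPartAt_nonneg A c)
    rw [integral_spectralMeasureAt_of_continuous hσ x hfc, hx,
      ← ContinuousLinearMap.adjoint_inner_left, hGs]
    have h2 : posPartAt A c (cfc f A (posPartAt A c y)) = cfc (fun t => g t * (f t * g t)) A y := by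
      rw [cfc_mul g (fun t => f t * g t) A hgc.continuousOn (hfc.mul hgc).continuousOn,
        cfc_mul f g A hfc.continuousOn hgc.continuousOn]
      rfl
    rw [h2]
    have hn : ‖cfc (fun t => g t * (f t * g t)) A‖ ≤ ε := norm_cfc_le hε.le fun t _ => by
      have : g t * (f t * g t) = ε * (g t ^ 2 / (ε + g t ^ 2)) := by rw [hf]; ring
      rw [this, Real.norm_of_nonneg (mul_nonneg hε.le (div_nonneg (sq_nonneg _) (hpos t).le))]
      refine mul_le_of_le_one_right hε.le ((div_le_one (hpos t)).2 (by linarith))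
    calc _ ≤ ‖inner ℂ (cfc (fun t => g t * (f t * g t)) A y) y‖ := RCLike.re_le_norm _
      _ ≤ ‖cfc (fun t => g t * (f t * g t)) A y‖ * ‖y‖ := norm_inner_le_norm _ _
      _ ≤ (ε * ‖y‖) * ‖y‖ := by
        gcongr
        exact (le_opNorm _ _).trans (by gcongr)
      _ = ε * ‖y‖ ^ 2 := by ring
  have h0 : (spectralMeasureAt A x).real (Set.Iic c) ≤ 0 := by
    refine le_of_forall_pos_le_add fun δ hδ => ?_
    -- The summand 1 keeps the choice of ε valid when y = 0.
    have hy : 0 < ‖y‖ ^ 2 + 1 := by positivity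
    refine (hb (δ / (‖y‖ ^ 2 + 1)) (by positivity)).trans ?_
    rw [zero_add, div_mul_eq_mul_div, div_le_iff₀ hy]
    nlinarith
  have h1 := le_antisymm h0 measureReal_nonneg
  exact (measureReal_eq_zero_iff).1 h1

theorem orthogonal_ker_posPartAt (A : E →L[ℂ] E) (c : ℝ) :
    (posPartAt A c).kerᗮ = (posPartAt A c).range.topologicalClosure := by
  have hGs : (posPartAt A c)† = posPartAt A c := IsSelfAdjoint.of_nonneg (posPartAt_nonneg A c)
  conv_lhs => rw [← hGs, ← ContinuousLinearMap.orthogonal_range,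
    Submodule.orthogonal_orthogonal_eq_closure]

theorem orthogonal_ker_posPartAt_le {c M : ℝ} (hσ : spectrum ℝ A ⊆ Set.Icc 0 M) :
    (posPartAt A c).kerᗮ ≤ spectralSubspace A (Set.Ioc c M) := by
  rw [orthogonal_ker_posPartAt]
  exact Submodule.topologicalClosure_minimal _ (range_posPartAt_le hσ)
    (isClosed_spectralSubspace _ _)

/-- The complements of two disjoint sets cover the line, so the spectral measure of a common vector
has total mass zero. -/
theorem spectralSubspace_inf_eq_bot {M : ℝ} (hA : IsSelfAdjoint A)
    (hσ : spectrum ℝ A ⊆ Set.Icc 0 M) {s t : Set ℝ} (hst : Disjoint s t) {x : E}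
    (hs : x ∈ spectralSubspace A s) (ht : x ∈ spectralSubspace A t) : x = 0 := by
  refine eq_zero_of_spectralMeasureAt_univ hA hσ ?_
  have h : (Set.univ : Set ℝ) = sᶜ ∪ tᶜ := by
    rw [← Set.compl_inter, hst.inter_eq, Set.compl_empty]
  rw [h]
  exact measure_union_null hs ht

/-- The kernel of (A - c)₊ and its complement lie in two spectral subspaces that meet only in 0. As
they already span the space, both inclusions are equalities. No spectral projection is needed. -/
theorem spectralSubspace_Icc_eq {c M : ℝ} (hA : IsSelfAdjoint A)
    (hσ : spectrum ℝ A ⊆ Set.Icc 0 M) :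
    spectralSubspace A (Set.Icc 0 c) = (posPartAt A c).ker := by
  have : CompleteSpace (posPartAt A c).ker := (posPartAt A c).isClosed_ker.completeSpace_coe
  refine le_antisymm (fun x hx => ?_) (ker_posPartAt_le hσ)
  obtain ⟨u, hu, v, hv, rfl⟩ := (posPartAt A c).ker.exists_add_mem_mem_orthogonal x
  have h1 : v ∈ spectralSubspace A (Set.Icc 0 c) := by
    have := sub_mem hx (ker_posPartAt_le hσ hu)
    rwa [add_sub_cancel_left] at this
  have h2 : v = 0 := spectralSubspace_inf_eq_bot hA hσ
    (Set.disjoint_left.2 fun t h h' => h'.1.not_ge h.2) h1 (orthogonal_ker_posPartAt_le hσ hv)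
  rwa [h2, add_zero]

theorem spectralSubspace_Ioc_eq {c M : ℝ} (hA : IsSelfAdjoint A)
    (hσ : spectrum ℝ A ⊆ Set.Icc 0 M) :
    spectralSubspace A (Set.Ioc c M) = (posPartAt A c).kerᗮ := by
  have : CompleteSpace (posPartAt A c).ker := (posPartAt A c).isClosed_ker.completeSpace_coe
  refine le_antisymm (fun x hx => ?_) (orthogonal_ker_posPartAt_le hσ)
  obtain ⟨u, hu, v, hv, rfl⟩ := (posPartAt A c).ker.exists_add_mem_mem_orthogonal x
  have h1 : u ∈ spectralSubspace A (Set.Ioc c M) := by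
    have := sub_mem hx (orthogonal_ker_posPartAt_le hσ hv)
    rwa [add_sub_cancel_right] at this
  have h2 : u = 0 := spectralSubspace_inf_eq_bot hA hσ
    (Set.disjoint_left.2 fun t h h' => h'.1.not_ge h.2) (ker_posPartAt_le hσ hu) h1
  rwa [h2, zero_add]

theorem apply_mem_orthogonal_of_isSelfAdjoint {R : E →L[ℂ] E} (hR : IsSelfAdjoint R)
    {p : Submodule ℂ E} (hp : ∀ x ∈ p, R x ∈ p) : ∀ x ∈ pᗮ, R x ∈ pᗮ := by
  intro x hx
  have hRs : R† = R := hR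
  rw [Submodule.mem_orthogonal] at hx ⊢
  intro u hu
  rw [← ContinuousLinearMap.adjoint_inner_left, hRs]
  exact hx _ (hp u hu)

/-- The square root commutes with its own square A, hence with every continuous function of A. -/
theorem opSqrt_apply_mem_ker (hA : 0 ≤ A) (c : ℝ) :
    ∀ x ∈ (posPartAt A c).ker, opSqrt A x ∈ (posPartAt A c).ker := by
  intro x hx
  have hx0 : posPartAt A c x = 0 := hx
  have h : Commute (posPartAt A c) (opSqrt A) := by
    have hA1 : IsSelfAdjoint A := IsSelfAdjoint.of_nonneg hA
    have h1 : Commute A (opSqrt A) := by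
      have h2 : opSqrt A * opSqrt A = A := CFC.sqrt_mul_sqrt_self A hA
      conv_lhs => rw [← h2]
      exact (Commute.refl _).mul_left (Commute.refl _)
    exact IsSelfAdjoint.commute_cfc hA1 h1 _
  have h2 := congrArg (fun T : E →L[ℂ] E => T x) h.eq
  simp only [mul_apply_eq_comp, hx0, map_zero] at h2
  exact h2

theorem opSqrt_apply_mem_spectralSubspace_Icc (hA : 0 ≤ A) {c M : ℝ}
    (hσ : spectrum ℝ A ⊆ Set.Icc 0 M) :
    ∀ x ∈ spectralSubspace A (Set.Icc 0 c), opSqrt A x ∈ spectralSubspace A (Set.Icc 0 c) := by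
  rw [spectralSubspace_Icc_eq (IsSelfAdjoint.of_nonneg hA) hσ]
  exact opSqrt_apply_mem_ker hA c

theorem opSqrt_apply_mem_spectralSubspace_Ioc (hA : 0 ≤ A) {c M : ℝ}
    (hσ : spectrum ℝ A ⊆ Set.Icc 0 M) :
    ∀ x ∈ spectralSubspace A (Set.Ioc c M), opSqrt A x ∈ spectralSubspace A (Set.Ioc c M) := by
  rw [spectralSubspace_Ioc_eq (IsSelfAdjoint.of_nonneg hA) hσ]
  exact apply_mem_orthogonal_of_isSelfAdjoint (opSqrt_isSelfAdjoint A) (opSqrt_apply_mem_ker hA c)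

/-- From A = c + (A - c)₊ - (A - c)₋. On each of the two spectral subspaces one of the parts
vanishes, which leaves a one-sided bound by c. -/
theorem re_inner_apply_self_eq (hA : IsSelfAdjoint A) (c : ℝ) (x : E) :
    RCLike.re (inner ℂ (A x) x) = c * ‖x‖ ^ 2 + RCLike.re (inner ℂ (posPartAt A c x) x) -
      RCLike.re (inner ℂ (negPartAt A c x) x) := by
  have h : A = (c : ℂ) • 1 + posPartAt A c - negPartAt A c := by
    rw [add_sub_assoc, posPartAt_sub_negPartAt hA]; abel
  conv_lhs => rw [h]
  simp only [sub_apply, add_apply, smul_apply, one_apply_eq_self, inner_sub_left, inner_add_left,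
    inner_smul_left, Complex.conj_ofReal, map_sub, map_add, inner_self_eq_norm_sq_to_K]
  congr 2
  simp [← Complex.ofReal_pow]

theorem re_inner_apply_self_le (hA : IsSelfAdjoint A) {c M : ℝ}
    (hσ : spectrum ℝ A ⊆ Set.Icc 0 M) {x : E} (hx : x ∈ spectralSubspace A (Set.Icc 0 c)) :
    RCLike.re (inner ℂ (A x) x) ≤ c * ‖x‖ ^ 2 := by
  rw [spectralSubspace_Icc_eq hA hσ] at hx
  have hx0 : posPartAt A c x = 0 := hx
  have h := ((ContinuousLinearMap.nonneg_iff_isPositive _).1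
    (negPartAt_nonneg A c)).re_inner_nonneg_left x
  rw [re_inner_apply_self_eq hA c, hx0, inner_zero_left, map_zero]
  linarith

theorem le_re_inner_apply_self (hA : IsSelfAdjoint A) {c M : ℝ}
    (hσ : spectrum ℝ A ⊆ Set.Icc 0 M) {x : E} (hx : x ∈ spectralSubspace A (Set.Ioc c M)) :
    c * ‖x‖ ^ 2 ≤ RCLike.re (inner ℂ (A x) x) := by
  rw [spectralSubspace_Ioc_eq hA hσ, orthogonal_ker_posPartAt] at hx
  -- The two parts multiply to zero, so (A - c)₋ kills the range of (A - c)₊, and its closure by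
  -- continuity.
  have hle : (posPartAt A c).range.topologicalClosure ≤ (negPartAt A c).ker := by
    refine Submodule.topologicalClosure_minimal _ ?_ (negPartAt A c).isClosed_ker
    rintro _ ⟨y, rfl⟩
    exact congrArg (fun T : E →L[ℂ] E => T y) (negPartAt_mul_posPartAt A c)
  have hx0 : negPartAt A c x = 0 := hle hx
  have h := ((ContinuousLinearMap.nonneg_iff_isPositive _).1
    (posPartAt_nonneg A c)).re_inner_nonneg_left x
  rw [re_inner_apply_self_eq hA c, hx0, inner_zero_left, map_zero]
  linarith

theorem spectrum_subset_Icc_of_norm_le (hA : 0 ≤ A) {M : ℝ} (hM : ‖A‖ ≤ M) :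
    spectrum ℝ A ⊆ Set.Icc 0 M := fun t ht =>
  ⟨spectrum_nonneg_of_nonneg hA ht, (Real.le_norm_self t).trans
    ((spectrum.norm_le_norm_mul_of_mem ht).trans
      ((mul_le_of_le_one_right (norm_nonneg _) norm_id_le).trans hM))⟩

end SpectralSubspaces

/-! ### Square roots and polar decompositions on spectral subspaces. -/

section PolarParts

set_option linter.unusedSectionVars false

variable {E F : Type*} [NormedAddCommGroup E] [InnerProductSpace ℂ E] [CompleteSpace E]
  [NormedAddCommGroup F] [InnerProductSpace ℂ F] [CompleteSpace F]

theorem ofReal_smul_one_le_adjoint_comp {c : ℝ} {D : E →L[ℂ] F}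
    (h : ∀ x, c * ‖x‖ ^ 2 ≤ ‖D x‖ ^ 2) : (c : ℂ) • 1 ≤ D† ∘L D := by
  rw [← sub_nonneg]
  refine (ContinuousLinearMap.nonneg_iff_isPositive _).2 (isPositive_def'.2 ⟨?_, fun x => ?_⟩)
  · refine (IsSelfAdjoint.of_nonneg (adjoint_comp_nonneg D)).sub ?_
    exact ofReal_smul_one_adjoint c
  · rw [reApplyInnerSelf_apply, sub_apply, smul_apply, one_apply_eq_self, comp_apply,
      inner_sub_left, ContinuousLinearMap.adjoint_inner_left, inner_smul_left, Complex.conj_ofReal,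
      inner_self_eq_norm_sq_to_K, inner_self_eq_norm_sq_to_K]
    have := h x
    simpa [← Complex.ofReal_pow] using this

theorem norm_opSqrt_apply_sq {A : E →L[ℂ] E} (hA : 0 ≤ A) (x : E) :
    ‖opSqrt A x‖ ^ 2 = RCLike.re (inner ℂ (A x) x) := by
  have h : opSqrt A * opSqrt A = A := CFC.sqrt_mul_sqrt_self A hA
  have hs : (opSqrt A)† = opSqrt A := opSqrt_isSelfAdjoint A
  conv_rhs => rw [← h, mul_apply_eq_comp]
  rw [← ContinuousLinearMap.adjoint_inner_right, hs, inner_self_eq_norm_sq]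

/-- On an invariant subspace the restriction of A^{1/2} is nonnegative and squares to the
restriction of A, so uniqueness identifies it. -/
theorem coe_opSqrt_spectralPart_apply {A : E →L[ℂ] E} (hA : 0 ≤ A) (hA' : IsSelfAdjoint A)
    {Δ : Set ℝ} (hinv : ∀ x ∈ spectralSubspace A Δ, opSqrt A x ∈ spectralSubspace A Δ)
    (x : spectralSubspace A Δ) :
    ((opSqrt (spectralPart A hA' Δ) x : spectralSubspace A Δ) : E) = opSqrt A x := by
  have h : opSqrt (spectralPart A hA' Δ) = (opSqrt A).restrict hinv := by
    have hp : (opSqrt A).IsPositive :=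
      (ContinuousLinearMap.nonneg_iff_isPositive _).1 (CFC.sqrt_nonneg A)
    refine opSqrt_eq_of_mul_self ((ContinuousLinearMap.nonneg_iff_isPositive _).2
      ⟨fun x y => hp.isSymmetric x y, fun x => hp.2 x⟩) ?_
    refine ContinuousLinearMap.ext fun x => Subtype.ext ?_
    exact congrArg (fun T : E →L[ℂ] E => T x) (CFC.sqrt_mul_sqrt_self A hA)
  rw [h]
  rfl

theorem coe_polarPart_adjoint_apply {A : E →L[ℂ] E} (hA : 0 ≤ A) (hA' : IsSelfAdjoint A)
    (V : E ≃ₗᵢ[ℂ] F) {Δ : Set ℝ}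
    (hinv : ∀ x ∈ spectralSubspace A Δ, opSqrt A x ∈ spectralSubspace A Δ)
    (x : spectralSubspace A Δ) :
    ((((polarPart A hA' V Δ)†) x : (spectralSubspace A Δ).map (V : E →ₗ[ℂ] F)) : F) =
      V (opSqrt A x) := by
  rw [polarPart, ContinuousLinearMap.adjoint_adjoint, ← coe_opSqrt_spectralPart_apply hA hA' hinv]
  rfl

/-- As V is unitary and A^{1/2} self-adjoint, the adjoint of V A^{1/2} is A^{1/2} V⁻¹; this is
checked weakly against vectors of the spectral subspace. -/
theorem coe_polarPart_apply {A : E →L[ℂ] E} (hA : 0 ≤ A) (hA' : IsSelfAdjoint A)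
    (V : E ≃ₗᵢ[ℂ] F) {Δ : Set ℝ}
    (hinv : ∀ x ∈ spectralSubspace A Δ, opSqrt A x ∈ spectralSubspace A Δ)
    (y : (spectralSubspace A Δ).map (V : E →ₗ[ℂ] F)) :
    ((polarPart A hA' V Δ y : spectralSubspace A Δ) : E) = opSqrt A (V.symm y) := by
  have hs : (opSqrt A)† = opSqrt A := opSqrt_isSelfAdjoint A
  have hy : V.symm y ∈ spectralSubspace A Δ := by
    obtain ⟨x, hx, hxy⟩ := y.2
    rw [← hxy]
    simpa using hx
  suffices h : polarPart A hA' V Δ y = ⟨opSqrt A (V.symm y), hinv _ hy⟩ from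
    congrArg Subtype.val h
  refine ext_inner_right ℂ fun x => ?_
  rw [← ContinuousLinearMap.adjoint_inner_right, Submodule.coe_inner, Submodule.coe_inner,
    coe_polarPart_adjoint_apply hA hA' V hinv, ← V.symm.inner_map_map, V.symm_apply_apply]
  conv_lhs => rw [← hs, ContinuousLinearMap.adjoint_inner_right]

theorem apply_eq_opSqrt_polarUnitary_symm (C : F →L[ℂ] E) (h : Function.Injective C)
    (h' : Function.Injective (C†)) (y : F) :
    C y = opSqrt (C ∘L C†) ((polarUnitary C h h').symm y) := by
  have hs : (opSqrt (C ∘L C†))† = opSqrt (C ∘L C†) := opSqrt_isSelfAdjoint _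
  refine ext_inner_right ℂ fun x => ?_
  rw [← ContinuousLinearMap.adjoint_inner_right, ← polarUnitary_apply C h h',
    ← (polarUnitary C h h').symm.inner_map_map, LinearIsometryEquiv.symm_apply_apply]
  conv_lhs => rw [← hs, ContinuousLinearMap.adjoint_inner_right]

end PolarParts

/-! ### The parts of B~ as restrictions of B. -/

section ReducedParts

variable {H K : Type*} [NormedAddCommGroup H] [InnerProductSpace ℂ H] [CompleteSpace H]
  [NormedAddCommGroup K] [InnerProductSpace ℂ K] [CompleteSpace K] (B : K →L[ℂ] H)

theorem reducedSq_nonneg : 0 ≤ reducedSq B := mul_adjoint_nonneg (reducedOp B)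

theorem norm_reducedSq_le : ‖reducedSq B‖ ≤ ‖B‖ ^ 2 := by
  have h1 : ‖reducedOp B‖ ≤ ‖B‖ := opNorm_le_bound _ (norm_nonneg _) fun x => B.le_opNorm x
  have h2 : ‖(reducedOp B)†‖ ≤ ‖B‖ := by
    rwa [LinearIsometryEquiv.norm_map]
  calc _ ≤ ‖reducedOp B‖ * ‖(reducedOp B)†‖ := opNorm_comp_le _ _
    _ ≤ ‖B‖ * ‖B‖ := by gcongr
    _ = ‖B‖ ^ 2 := by ring

theorem spectrum_reducedSq_subset : spectrum ℝ (reducedSq B) ⊆ Set.Icc 0 (‖B‖ ^ 2) :=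
  spectrum_subset_Icc_of_norm_le (reducedSq_nonneg B) (norm_reducedSq_le B)

theorem reducedOp_adjoint_apply (x : rangeClosure B) :
    ((reducedOp B)†) x = reducedPolar B (opSqrt (reducedSq B) x) :=
  (polarUnitary_apply (reducedOp B) (reducedOp_injective B) (reducedOp_adjoint_injective B) x).symm

theorem reducedOp_apply (y : kerPerp B) :
    reducedOp B y = opSqrt (reducedSq B) ((reducedPolar B).symm y) :=
  apply_eq_opSqrt_polarUnitary_symm (reducedOp B) (reducedOp_injective B)
    (reducedOp_adjoint_injective B) y

/-- Test both sides on N(B) and N(B)^⊥: on the kernel both give zero, and on its complement the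
identity is the definition of the adjoint of B~. -/
theorem coe_reducedOp_adjoint_apply (x : rangeClosure B) :
    ((((reducedOp B)†) x : kerPerp B) : K) = (B†) (x : H) := by
  have : CompleteSpace B.ker := B.isClosed_ker.completeSpace_coe
  refine ext_inner_right ℂ fun y => ?_
  obtain ⟨u, hu, v, hv, rfl⟩ := B.ker.exists_add_mem_mem_orthogonal y
  have hu' : B u = 0 := hu
  rw [ContinuousLinearMap.adjoint_inner_left, map_add, hu', zero_add, inner_add_right,
    Submodule.inner_left_of_mem_orthogonal hu (((reducedOp B)†) x).2, zero_add]
  change inner ℂ (((reducedOp B)†) x) (⟨v, hv⟩ : kerPerp B) = inner ℂ x (reducedOp B ⟨v, hv⟩)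
  rw [ContinuousLinearMap.adjoint_inner_left]

/-- The adjoint of `opPart B Δ`. -/
noncomputable abbrev opPartAdjoint (Δ : Set ℝ) : specH B Δ →L[ℂ] specK B Δ :=
  ContinuousLinearMap.adjoint (𝕜 := ℂ) (E := specK B Δ) (F := specH B Δ) (opPart B Δ)

variable {B} {Δ : Set ℝ}
-- The part acts as (B~B~*)^{1/2} V~⁻¹, which is B~ itself. Hence the parts, defined through the
-- polar decomposition, are plain restrictions of B.
theorem coe_opPart_apply
    (hinv : ∀ x ∈ specH B Δ, opSqrt (reducedSq B) x ∈ specH B Δ) (y : specK B Δ) :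
    (((opPart B Δ y : specH B Δ) : rangeClosure B) : H) = B ((y : kerPerp B) : K) := by
  have h := coe_polarPart_apply (reducedSq_nonneg B) (reducedSq_isSelfAdjoint B) (reducedPolar B)
    hinv y
  rw [← reducedOp_apply] at h
  exact congrArg Subtype.val h

theorem coe_opPart_adjoint_apply
    (hinv : ∀ x ∈ specH B Δ, opSqrt (reducedSq B) x ∈ specH B Δ) (x : specH B Δ) :
    (((opPartAdjoint B Δ x : specK B Δ) : kerPerp B) : K) = (B†) ((x : rangeClosure B) : H) := by
  have h := coe_polarPart_adjoint_apply (reducedSq_nonneg B) (reducedSq_isSelfAdjoint B)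
    (reducedPolar B) hinv x
  rw [← reducedOp_adjoint_apply] at h
  exact (congrArg Subtype.val h).trans (coe_reducedOp_adjoint_apply B _)

/-- The witness is V~⁻¹y. It turns spectral bounds for B~B~* into norm bounds for the part. -/
theorem norm_opPart_apply_sq
    (hinv : ∀ x ∈ specH B Δ, opSqrt (reducedSq B) x ∈ specH B Δ) (y : specK B Δ) :
    ∃ x : specH B Δ, ‖x‖ = ‖y‖ ∧ ‖opPart B Δ y‖ ^ 2 =
      RCLike.re (inner ℂ (reducedSq B x) (x : rangeClosure B)) := by
  obtain ⟨y, x, hx, rfl⟩ := y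
  refine ⟨⟨x, hx⟩, ((reducedPolar B).norm_map x).symm, ?_⟩
  have h := coe_polarPart_apply (reducedSq_nonneg B) (reducedSq_isSelfAdjoint B) (reducedPolar B)
    hinv ⟨reducedPolar B x, x, hx, rfl⟩
  rw [LinearIsometryEquiv.symm_apply_apply] at h
  rw [← norm_opSqrt_apply_sq (reducedSq_nonneg B), ← h]
  rfl

theorem norm_opPart_adjoint_apply_sq
    (hinv : ∀ x ∈ specH B Δ, opSqrt (reducedSq B) x ∈ specH B Δ) (x : specH B Δ) :
    ‖opPartAdjoint B Δ x‖ ^ 2 = RCLike.re (inner ℂ (reducedSq B x) (x : rangeClosure B)) := by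
  have h := coe_polarPart_adjoint_apply (reducedSq_nonneg B) (reducedSq_isSelfAdjoint B)
    (reducedPolar B) hinv x
  rw [← norm_opSqrt_apply_sq (reducedSq_nonneg B), ← (reducedPolar B).norm_map, ← h]
  rfl

end ReducedParts

/-! ### The unitary splitting of H ⊕ K. -/

section Splitting

set_option linter.unusedSectionVars false

variable {H K : Type*} [NormedAddCommGroup H] [InnerProductSpace ℂ H] [CompleteSpace H]
  [NormedAddCommGroup K] [InnerProductSpace ℂ K] [CompleteSpace K] (B : K →L[ℂ] H)

/-- The Hilbert space sum of `R(B)^⊥`, `N(B)` and the pairs of spectral subspaces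
for two Borel sets. -/
abbrev SplitSpace (Δ₁ Δ₂ : Set ℝ) : Type _ :=
  WithLp 2 ((B.rangeᗮ : Submodule ℂ H) × WithLp 2 (B.ker ×
    WithLp 2 (WithLp 2 (specH B Δ₁ × specK B Δ₁) × WithLp 2 (specH B Δ₂ × specK B Δ₂))))

/-- Summation of the components. -/
noncomputable def splitSum (Δ₁ Δ₂ : Set ℝ) : SplitSpace B Δ₁ Δ₂ →ₗ[ℂ] WithLp 2 (H × K) where
  toFun z := WithLp.toLp 2
    ((z.fst : H) + ((z.snd.snd.fst.fst : rangeClosure B) : H) +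
        ((z.snd.snd.snd.fst : rangeClosure B) : H),
      (z.snd.fst : K) + ((z.snd.snd.fst.snd : kerPerp B) : K) +
        ((z.snd.snd.snd.snd : kerPerp B) : K))
  map_add' z w := by
    refine congrArg (WithLp.toLp 2) (Prod.ext ?_ ?_)
    · change ((z.fst : H) + w.fst) +
          (((z.snd.snd.fst.fst : rangeClosure B) : H) + (w.snd.snd.fst.fst : rangeClosure B)) +
          (((z.snd.snd.snd.fst : rangeClosure B) : H) + (w.snd.snd.snd.fst : rangeClosure B)) =
        ((z.fst : H) + ((z.snd.snd.fst.fst : rangeClosure B) : H) +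
          ((z.snd.snd.snd.fst : rangeClosure B) : H)) +
        ((w.fst : H) + ((w.snd.snd.fst.fst : rangeClosure B) : H) +
          ((w.snd.snd.snd.fst : rangeClosure B) : H))
      abel
    · change ((z.snd.fst : K) + w.snd.fst) +
          (((z.snd.snd.fst.snd : kerPerp B) : K) + (w.snd.snd.fst.snd : kerPerp B)) +
          (((z.snd.snd.snd.snd : kerPerp B) : K) + (w.snd.snd.snd.snd : kerPerp B)) =
        ((z.snd.fst : K) + ((z.snd.snd.fst.snd : kerPerp B) : K) +
          ((z.snd.snd.snd.snd : kerPerp B) : K)) +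
        ((w.snd.fst : K) + ((w.snd.snd.fst.snd : kerPerp B) : K) +
          ((w.snd.snd.snd.snd : kerPerp B) : K))
      abel
  map_smul' r z := by
    refine congrArg (WithLp.toLp 2) (Prod.ext ?_ ?_)
    · change r • (z.fst : H) + r • ((z.snd.snd.fst.fst : rangeClosure B) : H) +
          r • ((z.snd.snd.snd.fst : rangeClosure B) : H) =
        r • ((z.fst : H) + ((z.snd.snd.fst.fst : rangeClosure B) : H) +
          ((z.snd.snd.snd.fst : rangeClosure B) : H))
      rw [smul_add, smul_add]
    · change r • (z.snd.fst : K) + r • ((z.snd.snd.fst.snd : kerPerp B) : K) +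
          r • ((z.snd.snd.snd.snd : kerPerp B) : K) =
        r • ((z.snd.fst : K) + ((z.snd.snd.fst.snd : kerPerp B) : K) +
          ((z.snd.snd.snd.snd : kerPerp B) : K))
      rw [smul_add, smul_add]

theorem splitSum_toLp (Δ₁ Δ₂ : Set ℝ) (x : (B.rangeᗮ : Submodule ℂ H)) (y : B.ker)
    (h₁ : specH B Δ₁) (k₁ : specK B Δ₁) (h₂ : specH B Δ₂) (k₂ : specK B Δ₂) :
    splitSum B Δ₁ Δ₂ (WithLp.toLp 2 (x, WithLp.toLp 2 (y, WithLp.toLp 2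
        (WithLp.toLp 2 (h₁, k₁), WithLp.toLp 2 (h₂, k₂))))) =
      WithLp.toLp 2 ((x : H) + ((h₁ : rangeClosure B) : H) + ((h₂ : rangeClosure B) : H),
        (y : K) + ((k₁ : kerPerp B) : K) + ((k₂ : kerPerp B) : K)) := rfl

theorem norm_sq_add_add {X : Type*} [NormedAddCommGroup X] [InnerProductSpace ℂ X] {x y z : X}
    (h₁ : inner ℂ x y = 0) (h₂ : inner ℂ x z = 0) (h₃ : inner ℂ y z = 0) :
    ‖x + y + z‖ ^ 2 = ‖x‖ ^ 2 + ‖y‖ ^ 2 + ‖z‖ ^ 2 := by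
  have h₄ : inner ℂ (x + y) z = 0 := by rw [inner_add_left, h₂, h₃, add_zero]
  have e₁ := norm_add_sq_eq_norm_sq_add_norm_sq_of_inner_eq_zero _ _ h₄
  have e₂ := norm_add_sq_eq_norm_sq_add_norm_sq_of_inner_eq_zero _ _ h₁
  simp only [sq]
  rw [e₁, e₂]

variable {B} {Δ₁ Δ₂ : Set ℝ}

theorem inner_range_orthogonal_coe (x : (B.rangeᗮ : Submodule ℂ H)) (y : rangeClosure B) :
    inner ℂ (x : H) (y : H) = 0 := by
  have h : (x : H) ∈ (rangeClosure B)ᗮ := by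
    rw [Submodule.orthogonal_closure]
    exact x.2
  exact Submodule.inner_left_of_mem_orthogonal y.2 h

theorem norm_splitSum (horth : ∀ x ∈ specH B Δ₁, ∀ y ∈ specH B Δ₂, inner ℂ x y = 0)
    (z : SplitSpace B Δ₁ Δ₂) : ‖splitSum B Δ₁ Δ₂ z‖ = ‖z‖ := by
  -- V~ preserves inner products, so orthogonality passes from the H side to the K side.
  have horthK : ∀ x ∈ specK B Δ₁, ∀ y ∈ specK B Δ₂, inner ℂ x y = 0 := by
    rintro _ ⟨x, hx, rfl⟩ _ ⟨y, hy, rfl⟩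
    exact ((reducedPolar B).inner_map_map x y).trans (horth x hx y hy)
  have hker : ∀ (x : B.ker) (y : kerPerp B), inner ℂ (x : K) (y : K) = 0 := fun x y =>
    Submodule.inner_right_of_mem_orthogonal x.2 y.2
  rw [← sq_eq_sq₀ (norm_nonneg _) (norm_nonneg _)]
  simp only [WithLp.prod_norm_sq_eq_of_L2]
  change ‖(z.fst : H) + ((z.snd.snd.fst.fst : rangeClosure B) : H) +
        ((z.snd.snd.snd.fst : rangeClosure B) : H)‖ ^ 2 +
      ‖(z.snd.fst : K) + ((z.snd.snd.fst.snd : kerPerp B) : K) +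
        ((z.snd.snd.snd.snd : kerPerp B) : K)‖ ^ 2 = _
  rw [norm_sq_add_add (inner_range_orthogonal_coe _ _) (inner_range_orthogonal_coe _ _)
      (horth _ z.snd.snd.fst.fst.2 _ z.snd.snd.snd.fst.2),
    norm_sq_add_add (hker _ _) (hker _ _)
      (horthK _ z.snd.snd.fst.snd.2 _ z.snd.snd.snd.snd.2)]
  simp only [Submodule.coe_norm]
  ring

theorem splitSum_surjective
    (hsup : ∀ x : rangeClosure B, ∃ u ∈ specH B Δ₁, ∃ v ∈ specH B Δ₂, u + v = x) :
    Function.Surjective (splitSum B Δ₁ Δ₂) := by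
  intro w
  have : CompleteSpace B.ker := B.isClosed_ker.completeSpace_coe
  obtain ⟨p, hp, q, hq, hpq⟩ := (rangeClosure B).exists_add_mem_mem_orthogonal w.fst
  rw [Submodule.orthogonal_closure] at hq
  obtain ⟨y, hy, k, hk, hyk⟩ := B.ker.exists_add_mem_mem_orthogonal w.snd
  obtain ⟨h₁, hh₁, h₂, hh₂, hh⟩ := hsup ⟨p, hp⟩
  -- The component in N(B)^⊥ is pulled back by V~, split there, and pushed forward again.
  obtain ⟨u₁, hu₁, u₂, hu₂, hu⟩ := hsup ((reducedPolar B).symm ⟨k, hk⟩)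
  have hu' : reducedPolar B u₁ + reducedPolar B u₂ = ⟨k, hk⟩ := by
    rw [← map_add, hu, LinearIsometryEquiv.apply_symm_apply]
  refine ⟨WithLp.toLp 2 (⟨q, hq⟩, WithLp.toLp 2 (⟨y, hy⟩, WithLp.toLp 2
    (WithLp.toLp 2 (⟨h₁, hh₁⟩, ⟨reducedPolar B u₁, u₁, hu₁, rfl⟩),
      WithLp.toLp 2 (⟨h₂, hh₂⟩, ⟨reducedPolar B u₂, u₂, hu₂, rfl⟩)))), ?_⟩
  change WithLp.toLp 2 (q + (h₁ : H) + (h₂ : H),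
    y + (reducedPolar B u₁ : K) + (reducedPolar B u₂ : K)) = w
  have e₁ : q + (h₁ : H) + (h₂ : H) = w.fst := by
    have := congrArg Subtype.val hh
    rw [add_assoc, ← Submodule.coe_add, this, hpq, add_comm]
  have e₂ : y + (reducedPolar B u₁ : K) + (reducedPolar B u₂ : K) = w.snd := by
    have := congrArg Subtype.val hu'
    rw [add_assoc, ← Submodule.coe_add, this, hyk]
  rw [e₁, e₂]
  rfl

/-- Summation of the components as a unitary operator. -/
noncomputable def splitUnitary (horth : ∀ x ∈ specH B Δ₁, ∀ y ∈ specH B Δ₂, inner ℂ x y = 0)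
    (hsup : ∀ x : rangeClosure B, ∃ u ∈ specH B Δ₁, ∃ v ∈ specH B Δ₂, u + v = x) :
    SplitSpace B Δ₁ Δ₂ ≃ₗᵢ[ℂ] WithLp 2 (H × K) :=
  LinearIsometryEquiv.ofSurjective ⟨splitSum B Δ₁ Δ₂, norm_splitSum horth⟩
    (splitSum_surjective hsup)

/-- B kills N(B), B* kills R(B)^⊥, and B and B* exchange the two spectral subspaces of each pair.
Thus Q is scalar on the first two summands and again of the form Q on each pair. -/
theorem Qop_splitSum (lam mu : ℝ)
    (hinv₁ : ∀ x ∈ specH B Δ₁, opSqrt (reducedSq B) x ∈ specH B Δ₁)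
    (hinv₂ : ∀ x ∈ specH B Δ₂, opSqrt (reducedSq B) x ∈ specH B Δ₂) (z : SplitSpace B Δ₁ Δ₂) :
    Qop lam mu B (splitSum B Δ₁ Δ₂ z) =
      splitSum B Δ₁ Δ₂ (directSumOp ((lam : ℂ) • 1) (directSumOp ((mu : ℂ) • 1)
        (directSumOp (Qop (E := specH B Δ₁) (F := specK B Δ₁) lam mu (opPart B Δ₁))
          (Qop (E := specH B Δ₂) (F := specK B Δ₂) lam mu (opPart B Δ₂)))) z) := by
  obtain ⟨x, y, h₁, k₁, h₂, k₂, rfl⟩ : ∃ x y h₁ k₁ h₂ k₂, z = WithLp.toLp 2 (x, WithLp.toLp 2 (y,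
      WithLp.toLp 2 (WithLp.toLp 2 (h₁, k₁), WithLp.toLp 2 (h₂, k₂)))) :=
    ⟨z.fst, z.snd.fst, z.snd.snd.fst.fst, z.snd.snd.fst.snd, z.snd.snd.snd.fst, z.snd.snd.snd.snd,
      rfl⟩
  have hx : (B†) (x : H) = 0 := by
    have h : ∀ v ∈ B.rangeᗮ, (B†) v = 0 := fun v hv => by
      rwa [ContinuousLinearMap.orthogonal_range] at hv
    exact h x x.2
  have hy : B (y : K) = 0 := y.2
  have e₁ := coe_opPart_apply hinv₁ k₁
  have e₂ := coe_opPart_apply hinv₂ k₂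
  have e₃ := coe_opPart_adjoint_apply hinv₁ h₁
  have e₄ := coe_opPart_adjoint_apply hinv₂ h₂
  have hd : directSumOp ((lam : ℂ) • 1) (directSumOp ((mu : ℂ) • 1)
        (directSumOp (Qop (E := specH B Δ₁) (F := specK B Δ₁) lam mu (opPart B Δ₁))
          (Qop (E := specH B Δ₂) (F := specK B Δ₂) lam mu (opPart B Δ₂))))
        (WithLp.toLp 2 (x, WithLp.toLp 2 (y,
          WithLp.toLp 2 (WithLp.toLp 2 (h₁, k₁), WithLp.toLp 2 (h₂, k₂))))) =
      WithLp.toLp 2 ((lam : ℂ) • x, WithLp.toLp 2 ((mu : ℂ) • y, WithLp.toLp 2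
        (WithLp.toLp 2 ((lam : ℂ) • h₁ + opPart B Δ₁ k₁, opPartAdjoint B Δ₁ h₁ + (mu : ℂ) • k₁),
          WithLp.toLp 2 ((lam : ℂ) • h₂ + opPart B Δ₂ k₂,
            opPartAdjoint B Δ₂ h₂ + (mu : ℂ) • k₂)))) := by
    simp only [directSumOp, blockOp_toLp, zero_apply, add_zero, zero_add]
    rfl
  rw [hd, splitSum_toLp, splitSum_toLp, Qop, blockOp_toLp]
  simp only [Submodule.coe_add, Submodule.coe_smul, e₁, e₂, e₃, e₄, map_add, hx, hy, smul_apply,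
    one_apply_eq_self]
  congr 2 <;> abel

end Splitting

/-! ### Absolute values under unitaries, in the sign cases and for direct sums. -/

section Cases

set_option linter.unusedSectionVars false

variable {H K : Type*} [NormedAddCommGroup H] [InnerProductSpace ℂ H] [CompleteSpace H]
  [NormedAddCommGroup K] [InnerProductSpace ℂ K] [CompleteSpace K]

/-- If a unitary `W` intertwines `A'` with the self-adjoint operator `A`, it intertwines `|A'|`
with `|A|`. -/
theorem opAbs_apply_of_intertwining (W : H ≃ₗᵢ[ℂ] K) {A : K →L[ℂ] K} {A' P : H →L[ℂ] H}
    (hA : IsSelfAdjoint A) (hW : ∀ z, A (W z) = W (A' z)) (hP : 0 ≤ P) (h : P * P = A' * A')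
    (z : H) : opAbs A (W z) = W (P z) := by
  have hp := (ContinuousLinearMap.nonneg_iff_isPositive _).1 hP
  -- The operator W P W⁻¹ is nonnegative and squares to A², so it is |A| by uniqueness.
  set R : K →L[ℂ] K := (W.toContinuousLinearEquiv : H →L[ℂ] K) ∘L P ∘L
    (W.symm.toContinuousLinearEquiv : K →L[ℂ] H) with hR
  have hRa : ∀ w, R w = W (P (W.symm w)) := fun _ => rfl
  have h0 : 0 ≤ R := by
    refine (ContinuousLinearMap.nonneg_iff_isPositive _).2 ⟨fun u v => ?_, fun u => ?_⟩
    · change inner ℂ (R u) v = inner ℂ u (R v)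
      rw [hRa, hRa, ← W.symm.inner_map_map, ← W.symm.inner_map_map u, W.symm_apply_apply,
        W.symm_apply_apply]
      exact hp.isSymmetric _ _
    · rw [reApplyInnerSelf_apply, hRa, ← W.symm.inner_map_map, W.symm_apply_apply]
      exact hp.2 _
  have h1 : R * R = A * A := by
    refine ContinuousLinearMap.ext fun w => ?_
    obtain ⟨u, rfl⟩ := W.surjective w
    rw [mul_apply_eq_comp, mul_apply_eq_comp, hRa, hRa, hW, hW, W.symm_apply_apply,
      W.symm_apply_apply]
    exact congrArg (fun T : H →L[ℂ] H => W (T u)) h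
  rw [opAbs_eq_of_mul_self hA h0 h1, hRa, W.symm_apply_apply]

theorem ofReal_abs_smul_one_mul_self (r : ℝ) :
    (((|r| : ℝ) : ℂ) • 1 : H →L[ℂ] H) * (((|r| : ℝ) : ℂ) • 1) = ((r : ℂ) • 1) * ((r : ℂ) • 1) := by
  rw [smul_mul_smul_comm, smul_mul_smul_comm, ← Complex.ofReal_mul, ← Complex.ofReal_mul,
    abs_mul_abs_self]

theorem opAbs_Qop_of_mu_eq_zero {lam : ℝ} (hl : lam ≠ 0) (B : K →L[ℂ] H) :
    IsUnit (rootT lam 0 B) ∧ opAbs (Qop lam 0 B) =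
        blockOp ((1 / 2 : ℂ) • (rootT lam 0 B + ((lam ^ 2 : ℝ) : ℂ) • Ring.inverse (rootT lam 0 B)))
          ((lam : ℂ) • (Ring.inverse (rootT lam 0 B) ∘L B))
          ((lam : ℂ) • (B† ∘L Ring.inverse (rootT lam 0 B)))
          ((2 : ℂ) • (B† ∘L Ring.inverse (rootT lam 0 B) ∘L B)) := by
  have hE : ((0 : ℝ) : ℂ) • 1 ≤ B ∘L B† := by simpa using mul_adjoint_nonneg B
  have hF : ((0 : ℝ) : ℂ) • 1 ≤ B† ∘L B := by simpa using adjoint_comp_nonneg B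
  have hc : 0 < (0 - lam) ^ 2 + 4 * 0 := by simpa using sq_pos_of_ne_zero hl
  have hT := isUnit_rootT hE hc
  have hS := isUnit_rootS hF hc
  refine ⟨hT, ?_⟩
  rw [opAbs_Qop_eq_highBlock (by simp) hc hE hF]
  -- This is T⁻¹ applied to T² = lam² + 4BB*. It rewrites T⁻¹(2BB* + lam²) as half of T + lam² T⁻¹.
  have key : ∀ x, rootT lam 0 B x = (lam ^ 2 : ℂ) • Ring.inverse (rootT lam 0 B) x +
      (4 : ℂ) • Ring.inverse (rootT lam 0 B) (B ((B†) x)) := fun x => by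
    have h := congrArg (fun A : H →L[ℂ] H => A x) (rootT_mul_self lam 0 B)
    simp only [mul_apply_eq_comp] at h
    rw [← ringInverse_apply_apply hT (rootT lam 0 B x), h]
    simp
  refine blockOp_ext fun x y => ?_
  simp only [highBlock, blockOp_toLp, comp_apply, add_apply, sub_apply, smul_apply,
    one_apply_eq_self, map_add, map_sub, map_smul, key, ringInverse_rootT_apply hT hS]
  push_cast
  congr 2 <;> module

theorem opAbs_Qop_of_lam_eq_zero {mu : ℝ} (hm : mu ≠ 0) (B : K →L[ℂ] H) :
    IsUnit (rootS 0 mu B) ∧ opAbs (Qop 0 mu B) =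
        blockOp ((2 : ℂ) • (B ∘L Ring.inverse (rootS 0 mu B) ∘L B†))
          ((mu : ℂ) • (B ∘L Ring.inverse (rootS 0 mu B)))
          ((mu : ℂ) • (Ring.inverse (rootS 0 mu B) ∘L B†))
          ((1 / 2 : ℂ) • (rootS 0 mu B +
            ((mu ^ 2 : ℝ) : ℂ) • Ring.inverse (rootS 0 mu B))) := by
  have hE : ((0 : ℝ) : ℂ) • 1 ≤ B ∘L B† := by simpa using mul_adjoint_nonneg B
  have hF : ((0 : ℝ) : ℂ) • 1 ≤ B† ∘L B := by simpa using adjoint_comp_nonneg B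
  have hc : 0 < (mu - 0) ^ 2 + 4 * 0 := by simpa using sq_pos_of_ne_zero hm
  have hT := isUnit_rootT hE hc
  have hS := isUnit_rootS hF hc
  refine ⟨hS, ?_⟩
  rw [opAbs_Qop_eq_highBlock (by simp) hc hE hF]
  have key : ∀ y, rootS 0 mu B y = (mu ^ 2 : ℂ) • Ring.inverse (rootS 0 mu B) y +
      (4 : ℂ) • (B†) (B (Ring.inverse (rootS 0 mu B) y)) := fun y => by
    have h := congrArg (fun A : K →L[ℂ] K => A (Ring.inverse (rootS 0 mu B) y))
      (rootS_mul_self 0 mu B)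
    simp only [mul_apply_eq_comp] at h
    rw [apply_ringInverse_apply hS] at h
    rw [h]
    simp
  refine blockOp_ext fun x y => ?_
  simp only [highBlock, blockOp_toLp, comp_apply, add_apply, sub_apply, smul_apply,
    one_apply_eq_self, map_add, map_sub, map_smul, key, ringInverse_rootT_apply hT hS,
    ringInverse_rootS_apply_adjoint hT hS]
  push_cast
  congr 2 <;> module

/-- The trivial lower bound c = 0 is enough because lam mu < 0. The matrix differs from `highBlock`
only in the side on which S⁻¹ stands in the last entry. -/
theorem opAbs_Qop_of_mul_neg {lam mu : ℝ} (h : mu * lam < 0) (B : K →L[ℂ] H) :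
    IsUnit (rootT lam mu B) ∧ IsUnit (rootS lam mu B) ∧ opAbs (Qop lam mu B) =
        blockOp
          (Ring.inverse (rootT lam mu B) ∘L ((2 : ℂ) • (B ∘L B†) - ((lam * mu : ℝ) : ℂ) • 1
            + ((lam ^ 2 : ℝ) : ℂ) • 1))
          (((lam + mu : ℝ) : ℂ) • (Ring.inverse (rootT lam mu B) ∘L B))
          (((lam + mu : ℝ) : ℂ) • (B† ∘L Ring.inverse (rootT lam mu B)))
          (Ring.inverse (rootS lam mu B) ∘L (((mu ^ 2 : ℝ) : ℂ) • 1 - ((lam * mu : ℝ) : ℂ) • 1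
            + (2 : ℂ) • (B† ∘L B))) := by
  have hE : ((0 : ℝ) : ℂ) • 1 ≤ B ∘L B† := by simpa using mul_adjoint_nonneg B
  have hF : ((0 : ℝ) : ℂ) • 1 ≤ B† ∘L B := by simpa using adjoint_comp_nonneg B
  have hne : mu - lam ≠ 0 := fun h0 => by
    rw [sub_eq_zero.1 h0] at h
    exact absurd h (mul_self_nonneg lam).not_gt
  have hc : 0 < (mu - lam) ^ 2 + 4 * 0 := by simpa using sq_pos_of_ne_zero hne
  have hT := isUnit_rootT hE hc
  have hS := isUnit_rootS hF hc
  refine ⟨hT, hS, ?_⟩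
  rw [opAbs_Qop_eq_highBlock (by linarith [mul_comm lam mu]) hc hE hF]
  refine blockOp_ext fun x y => ?_
  simp only [highBlock, blockOp_toLp, comp_apply, add_apply, sub_apply, smul_apply,
    one_apply_eq_self, map_add, map_sub, map_smul, ringInverse_rootT_apply hT hS,
    ringInverse_rootS_apply_adjoint hT hS]

/-- The norm bound form of `opAbs_Qop_eq_highBlock`, with invertibility of the roots. -/
theorem opAbs_Qop_of_le_norm {lam mu c : ℝ} {C : K →L[ℂ] H} (hlm : lam * mu ≤ c)
    (hc : 0 < (mu - lam) ^ 2 + 4 * c) (hE : ∀ x, c * ‖x‖ ^ 2 ≤ ‖(C†) x‖ ^ 2)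
    (hF : ∀ y, c * ‖y‖ ^ 2 ≤ ‖C y‖ ^ 2) :
    IsUnit (rootT lam mu C) ∧ IsUnit (rootS lam mu C) ∧
      opAbs (Qop lam mu C) = highBlock lam mu C := by
  have hE' := ofReal_smul_one_le_adjoint_comp hE
  rw [ContinuousLinearMap.adjoint_adjoint] at hE'
  have hF' := ofReal_smul_one_le_adjoint_comp hF
  exact ⟨isUnit_rootT hE' hc, isUnit_rootS hF' hc, opAbs_Qop_eq_highBlock hlm hc hE' hF'⟩

/-- The absolute value of a direct sum of scalars and operators `Q`. -/
theorem directSumOp_opAbs {X Y E₁ F₁ E₂ F₂ : Type*}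
    [NormedAddCommGroup X] [InnerProductSpace ℂ X] [CompleteSpace X]
    [NormedAddCommGroup Y] [InnerProductSpace ℂ Y] [CompleteSpace Y]
    [NormedAddCommGroup E₁] [InnerProductSpace ℂ E₁] [CompleteSpace E₁]
    [NormedAddCommGroup F₁] [InnerProductSpace ℂ F₁] [CompleteSpace F₁]
    [NormedAddCommGroup E₂] [InnerProductSpace ℂ E₂] [CompleteSpace E₂]
    [NormedAddCommGroup F₂] [InnerProductSpace ℂ F₂] [CompleteSpace F₂]
    (lam mu : ℝ) {C₁ : F₁ →L[ℂ] E₁} {C₂ : F₂ →L[ℂ] E₂}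
    {R₁ : WithLp 2 (E₁ × F₁) →L[ℂ] WithLp 2 (E₁ × F₁)}
    {R₂ : WithLp 2 (E₂ × F₂) →L[ℂ] WithLp 2 (E₂ × F₂)}
    (h₁ : opAbs (Qop lam mu C₁) = R₁) (h₂ : opAbs (Qop lam mu C₂) = R₂) :
    0 ≤ directSumOp (((|lam| : ℝ) : ℂ) • 1 : X →L[ℂ] X)
      (directSumOp (((|mu| : ℝ) : ℂ) • 1 : Y →L[ℂ] Y) (directSumOp R₁ R₂)) ∧
    directSumOp (((|lam| : ℝ) : ℂ) • 1 : X →L[ℂ] X)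
        (directSumOp (((|mu| : ℝ) : ℂ) • 1 : Y →L[ℂ] Y) (directSumOp R₁ R₂)) *
      directSumOp (((|lam| : ℝ) : ℂ) • 1 : X →L[ℂ] X)
        (directSumOp (((|mu| : ℝ) : ℂ) • 1 : Y →L[ℂ] Y) (directSumOp R₁ R₂)) =
    directSumOp ((lam : ℂ) • 1 : X →L[ℂ] X) (directSumOp ((mu : ℂ) • 1 : Y →L[ℂ] Y)
        (directSumOp (Qop lam mu C₁) (Qop lam mu C₂))) *
      directSumOp ((lam : ℂ) • 1 : X →L[ℂ] X) (directSumOp ((mu : ℂ) • 1 : Y →L[ℂ] Y)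
        (directSumOp (Qop lam mu C₁) (Qop lam mu C₂))) := by
  subst h₁ h₂
  refine ⟨directSumOp_nonneg (smul_one_nonneg (abs_nonneg _))
    (directSumOp_nonneg (smul_one_nonneg (abs_nonneg _))
      (directSumOp_nonneg (opAbs_nonneg _) (opAbs_nonneg _))), ?_⟩
  simp only [directSumOp_mul]
  rw [ofReal_abs_smul_one_mul_self, ofReal_abs_smul_one_mul_self, opAbs_Qop_mul_self,
    opAbs_Qop_mul_self]

/-- The absolute value of an operator unitarily equivalent to a sum of scalars, of an operator `Q`
with `‖C₁‖² ≤ lam * mu` and of an operator `Q` with `C₂` bounded below by `lam * mu`. -/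
theorem opAbs_apply_of_directSumOp {X Y E₁ F₁ E₂ F₂ Z : Type*}
    [NormedAddCommGroup X] [InnerProductSpace ℂ X] [CompleteSpace X]
    [NormedAddCommGroup Y] [InnerProductSpace ℂ Y] [CompleteSpace Y]
    [NormedAddCommGroup E₁] [InnerProductSpace ℂ E₁] [CompleteSpace E₁]
    [NormedAddCommGroup F₁] [InnerProductSpace ℂ F₁] [CompleteSpace F₁]
    [NormedAddCommGroup E₂] [InnerProductSpace ℂ E₂] [CompleteSpace E₂]
    [NormedAddCommGroup F₂] [InnerProductSpace ℂ F₂] [CompleteSpace F₂]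
    [NormedAddCommGroup Z] [InnerProductSpace ℂ Z] [CompleteSpace Z]
    {lam mu : ℝ} (h : 0 < mu * lam) {C₁ : F₁ →L[ℂ] E₁} {C₂ : F₂ →L[ℂ] E₂}
    (h₁ : ∀ y, ‖C₁ y‖ ^ 2 ≤ mu * lam * ‖y‖ ^ 2)
    (h₂ : ∀ x, mu * lam * ‖x‖ ^ 2 ≤ ‖(C₂†) x‖ ^ 2) (h₃ : ∀ y, mu * lam * ‖y‖ ^ 2 ≤ ‖C₂ y‖ ^ 2)
    {A : Z →L[ℂ] Z} (hA : IsSelfAdjoint A)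
    (W : WithLp 2 (X × WithLp 2 (Y × WithLp 2 (WithLp 2 (E₁ × F₁) × WithLp 2 (E₂ × F₂)))) ≃ₗᵢ[ℂ] Z)
    (hW : ∀ z, A (W z) = W (directSumOp ((lam : ℂ) • 1) (directSumOp ((mu : ℂ) • 1)
        (directSumOp (Qop lam mu C₁) (Qop lam mu C₂))) z)) :
    IsUnit (rootT lam mu C₂) ∧ IsUnit (rootS lam mu C₂) ∧
      ∀ z, opAbs A (W z) = W (directSumOp (((|lam| : ℝ) : ℂ) • 1)
        (directSumOp (((|mu| : ℝ) : ℂ) • 1)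
          (directSumOp (((|lam| : ℝ) : ℂ) • lowBlock lam mu C₁) (highBlock lam mu C₂))) z) := by
  have hlow := opAbs_Qop_eq_lowBlock (by rwa [mul_comm]) fun y => by
    rw [mul_comm lam mu]; exact h₁ y
  -- The lower bound c is lam mu itself; positivity of the product then gives invertibility of the
  -- roots, even when lam = mu.
  obtain ⟨hT, hS, hhigh⟩ := opAbs_Qop_of_le_norm (mul_comm lam mu).le
    (by nlinarith [sq_nonneg (mu - lam)]) h₂ h₃
  have hP := directSumOp_opAbs (X := X) (Y := Y) lam mu hlow hhigh
  exact ⟨hT, hS, opAbs_apply_of_intertwining W hA hW hP.1 hP.2⟩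

/-! ### The spectral cut of B~B~* at c applied to Q. -/

variable (B : K →L[ℂ] H) {c : ℝ}

theorem inner_specH_Icc_specH_Ioc :
    ∀ x ∈ specH B (Set.Icc 0 c), ∀ y ∈ specH B (Set.Ioc c (‖B‖ ^ 2)), inner ℂ x y = 0 := by
  intro x hx y hy
  rw [specH, spectralSubspace_Icc_eq (reducedSq_isSelfAdjoint B) (spectrum_reducedSq_subset B)] at hx
  rw [specH, spectralSubspace_Ioc_eq (reducedSq_isSelfAdjoint B) (spectrum_reducedSq_subset B)] at hy
  exact Submodule.inner_right_of_mem_orthogonal hx hy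

theorem exists_specH_Icc_add_specH_Ioc (x : rangeClosure B) :
    ∃ u ∈ specH B (Set.Icc 0 c), ∃ v ∈ specH B (Set.Ioc c (‖B‖ ^ 2)), u + v = x := by
  rw [specH, specH,
    spectralSubspace_Icc_eq (reducedSq_isSelfAdjoint B) (spectrum_reducedSq_subset B),
    spectralSubspace_Ioc_eq (reducedSq_isSelfAdjoint B) (spectrum_reducedSq_subset B)]
  have : CompleteSpace (posPartAt (reducedSq B) c).ker :=
    (posPartAt (reducedSq B) c).isClosed_ker.completeSpace_coe
  obtain ⟨u, hu, v, hv, h⟩ :=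
    (posPartAt (reducedSq B) c).ker.exists_add_mem_mem_orthogonal x
  exact ⟨u, hu, v, hv, h.symm⟩

theorem opSqrt_mem_specH_Icc :
    ∀ x ∈ specH B (Set.Icc 0 c), opSqrt (reducedSq B) x ∈ specH B (Set.Icc 0 c) :=
  opSqrt_apply_mem_spectralSubspace_Icc (reducedSq_nonneg B) (spectrum_reducedSq_subset B)

theorem opSqrt_mem_specH_Ioc :
    ∀ x ∈ specH B (Set.Ioc c (‖B‖ ^ 2)),
      opSqrt (reducedSq B) x ∈ specH B (Set.Ioc c (‖B‖ ^ 2)) :=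
  opSqrt_apply_mem_spectralSubspace_Ioc (reducedSq_nonneg B) (spectrum_reducedSq_subset B)

theorem norm_opPart_Icc_apply_sq_le (y : specK B (Set.Icc 0 c)) :
    ‖opPart B (Set.Icc 0 c) y‖ ^ 2 ≤ c * ‖y‖ ^ 2 := by
  obtain ⟨x, hx, h⟩ := norm_opPart_apply_sq (opSqrt_mem_specH_Icc B) y
  rw [h, ← hx]
  exact re_inner_apply_self_le (reducedSq_isSelfAdjoint B) (spectrum_reducedSq_subset B) x.2

theorem le_norm_opPart_Ioc_apply_sq (y : specK B (Set.Ioc c (‖B‖ ^ 2))) :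
    c * ‖y‖ ^ 2 ≤ ‖opPart B (Set.Ioc c (‖B‖ ^ 2)) y‖ ^ 2 := by
  obtain ⟨x, hx, h⟩ := norm_opPart_apply_sq (opSqrt_mem_specH_Ioc B) y
  rw [h, ← hx]
  exact le_re_inner_apply_self (reducedSq_isSelfAdjoint B) (spectrum_reducedSq_subset B) x.2

theorem le_norm_opPartAdjoint_Ioc_apply_sq (x : specH B (Set.Ioc c (‖B‖ ^ 2))) :
    c * ‖x‖ ^ 2 ≤ ‖opPartAdjoint B (Set.Ioc c (‖B‖ ^ 2)) x‖ ^ 2 := by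
  rw [norm_opPart_adjoint_apply_sq (opSqrt_mem_specH_Ioc B)]
  exact le_re_inner_apply_self (reducedSq_isSelfAdjoint B) (spectrum_reducedSq_subset B) x.2

theorem opAbs_Qop_splitUnitary {Δ₁ Δ₂ : Set ℝ} {lam mu : ℝ} (h : 0 < mu * lam)
    (hinv₁ : ∀ x ∈ specH B Δ₁, opSqrt (reducedSq B) x ∈ specH B Δ₁)
    (hinv₂ : ∀ x ∈ specH B Δ₂, opSqrt (reducedSq B) x ∈ specH B Δ₂)
    (horth : ∀ x ∈ specH B Δ₁, ∀ y ∈ specH B Δ₂, inner ℂ x y = 0)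
    (hsup : ∀ x : rangeClosure B, ∃ u ∈ specH B Δ₁, ∃ v ∈ specH B Δ₂, u + v = x)
    (h₁ : ∀ y : specK B Δ₁, ‖opPart B Δ₁ y‖ ^ 2 ≤ mu * lam * ‖y‖ ^ 2)
    (h₂ : ∀ x : specH B Δ₂, mu * lam * ‖x‖ ^ 2 ≤ ‖opPartAdjoint B Δ₂ x‖ ^ 2)
    (h₃ : ∀ y : specK B Δ₂, mu * lam * ‖y‖ ^ 2 ≤ ‖opPart B Δ₂ y‖ ^ 2) :
    IsUnit (rootT (E := specH B Δ₂) (F := specK B Δ₂) lam mu (opPart B Δ₂)) ∧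
    IsUnit (rootS (E := specH B Δ₂) (F := specK B Δ₂) lam mu (opPart B Δ₂)) ∧
    ∀ z : SplitSpace B Δ₁ Δ₂, opAbs (Qop lam mu B) (splitUnitary horth hsup z) =
      splitUnitary horth hsup (directSumOp (((|lam| : ℝ) : ℂ) • 1)
        (directSumOp (((|mu| : ℝ) : ℂ) • 1)
          (directSumOp (E := WithLp 2 (specH B Δ₁ × specK B Δ₁))
            (F := WithLp 2 (specH B Δ₂ × specK B Δ₂))
            (((|lam| : ℝ) : ℂ) •
              lowBlock (E := specH B Δ₁) (F := specK B Δ₁) lam mu (opPart B Δ₁))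
            (highBlock (E := specH B Δ₂) (F := specK B Δ₂) lam mu (opPart B Δ₂)))) z) := by
  have hX : CompleteSpace (B.rangeᗮ : Submodule ℂ H) :=
    (Submodule.isClosed_orthogonal _).completeSpace_coe
  have hY : CompleteSpace B.ker := B.isClosed_ker.completeSpace_coe
  refine opAbs_apply_of_directSumOp (E₁ := specH B Δ₁) (F₁ := specK B Δ₁) (E₂ := specH B Δ₂)
    (F₂ := specK B Δ₂) (X := (B.rangeᗮ : Submodule ℂ H)) (Y := B.ker) (Z := WithLp 2 (H × K)) h
    ?_ ?_ ?_ (Qop_isSelfAdjoint lam mu B) _ ?_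
  · exact h₁
  · exact h₂
  · exact h₃
  · exact Qop_splitSum lam mu hinv₁ hinv₂

theorem exists_unitary_opAbs_Qop {Δ₁ Δ₂ : Set ℝ} {lam mu : ℝ} (h : 0 < mu * lam)
    (hinv₁ : ∀ x ∈ specH B Δ₁, opSqrt (reducedSq B) x ∈ specH B Δ₁)
    (hinv₂ : ∀ x ∈ specH B Δ₂, opSqrt (reducedSq B) x ∈ specH B Δ₂)
    (horth : ∀ x ∈ specH B Δ₁, ∀ y ∈ specH B Δ₂, inner ℂ x y = 0)
    (hsup : ∀ x : rangeClosure B, ∃ u ∈ specH B Δ₁, ∃ v ∈ specH B Δ₂, u + v = x)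
    (h₁ : ∀ y : specK B Δ₁, ‖opPart B Δ₁ y‖ ^ 2 ≤ mu * lam * ‖y‖ ^ 2)
    (h₂ : ∀ x : specH B Δ₂, mu * lam * ‖x‖ ^ 2 ≤ ‖opPartAdjoint B Δ₂ x‖ ^ 2)
    (h₃ : ∀ y : specK B Δ₂, mu * lam * ‖y‖ ^ 2 ≤ ‖opPart B Δ₂ y‖ ^ 2) :
    let B₁ : specK B Δ₁ →L[ℂ] specH B Δ₁ := opPart B Δ₁
    let B₂ : specK B Δ₂ →L[ℂ] specH B Δ₂ := opPart B Δ₂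
    IsUnit (rootT (E := specH B Δ₂) (F := specK B Δ₂) lam mu B₂) ∧
    IsUnit (rootS (E := specH B Δ₂) (F := specK B Δ₂) lam mu B₂) ∧
    ∃ W : WithLp 2 ((B.rangeᗮ : Submodule ℂ H) × WithLp 2 (B.ker ×
            WithLp 2 (WithLp 2 (specH B Δ₁ × specK B Δ₁) ×
              WithLp 2 (specH B Δ₂ × specK B Δ₂)))) ≃ₗᵢ[ℂ] WithLp 2 (H × K),
      (∀ (x : (B.rangeᗮ : Submodule ℂ H)) (y : B.ker) (h₁ : specH B Δ₁) (k₁ : specK B Δ₁)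
          (h₂ : specH B Δ₂) (k₂ : specK B Δ₂),
        W (WithLp.toLp 2 (x, WithLp.toLp 2 (y, WithLp.toLp 2
            (WithLp.toLp 2 (h₁, k₁), WithLp.toLp 2 (h₂, k₂))))) =
          WithLp.toLp 2 ((x : H) + ((h₁ : rangeClosure B) : H) + ((h₂ : rangeClosure B) : H),
            (y : K) + ((k₁ : kerPerp B) : K) + ((k₂ : kerPerp B) : K))) ∧
      ∀ z, opAbs (Qop lam mu B) (W z) =
        W (directSumOp (((|lam| : ℝ) : ℂ) • 1)
            (directSumOp (((|mu| : ℝ) : ℂ) • 1)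
              (directSumOp (((|lam| : ℝ) : ℂ) • lowBlock lam mu B₁)
                (highBlock lam mu B₂))) z) := by
  intro B₁ B₂
  obtain ⟨hT, hS, hW⟩ := opAbs_Qop_splitUnitary B h hinv₁ hinv₂ horth hsup h₁ h₂ h₃
  refine ⟨hT, hS, splitUnitary horth hsup, splitSum_toLp B Δ₁ Δ₂, ?_⟩
  intro z
  exact hW z

end Cases

/-! ### The six cases together. -/

theorem theorem5 {H K : Type*}
    [NormedAddCommGroup H] [InnerProductSpace ℂ H] [CompleteSpace H]
    [NormedAddCommGroup K] [InnerProductSpace ℂ K] [CompleteSpace K]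
    (lam mu : ℝ) (B : K →L[ℂ] H) :
    -- both scalars vanish
    (lam = 0 → mu = 0 →
      opAbs (Qop lam mu B) = blockOp (opAbs (B†)) 0 0 (opAbs B)) ∧
    -- only `mu` vanishes
    (lam ≠ 0 → mu = 0 →
      let T : H →L[ℂ] H := opSqrt (((lam ^ 2 : ℝ) : ℂ) • 1 + (4 : ℂ) • (B ∘L B†))
      IsUnit T ∧
      opAbs (Qop lam mu B) =
        blockOp ((1 / 2 : ℂ) • (T + ((lam ^ 2 : ℝ) : ℂ) • Ring.inverse T))
          ((lam : ℂ) • (Ring.inverse T ∘L B))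
          ((lam : ℂ) • (B† ∘L Ring.inverse T))
          ((2 : ℂ) • (B† ∘L Ring.inverse T ∘L B))) ∧
    -- large positive product
    (0 < ‖B‖ ^ 2 → ‖B‖ ^ 2 ≤ mu * lam →
      opAbs (Qop lam mu B) = ((|lam| / lam : ℝ) : ℂ) • Qop lam mu B) ∧
    -- negative product
    (mu * lam < 0 →
      let T : H →L[ℂ] H := rootT lam mu B
      let S : K →L[ℂ] K := rootS lam mu B
      IsUnit T ∧ IsUnit S ∧
      opAbs (Qop lam mu B) =
        blockOp
          (Ring.inverse T ∘L ((2 : ℂ) • (B ∘L B†) - ((lam * mu : ℝ) : ℂ) • 1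
            + ((lam ^ 2 : ℝ) : ℂ) • 1))
          (((lam + mu : ℝ) : ℂ) • (Ring.inverse T ∘L B))
          (((lam + mu : ℝ) : ℂ) • (B† ∘L Ring.inverse T))
          (Ring.inverse S ∘L (((mu ^ 2 : ℝ) : ℂ) • 1 - ((lam * mu : ℝ) : ℂ) • 1
            + (2 : ℂ) • (B† ∘L B)))) ∧
    -- small positive product
    (0 < mu * lam → mu * lam < ‖B‖ ^ 2 →
      let I₁ : Set ℝ := Set.Icc 0 (mu * lam)
      let I₂ : Set ℝ := Set.Ioc (mu * lam) (‖B‖ ^ 2)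
      let B₁ : specK B I₁ →L[ℂ] specH B I₁ := opPart B I₁
      let B₂ : specK B I₂ →L[ℂ] specH B I₂ := opPart B I₂
      IsUnit (rootT (E := specH B I₂) (F := specK B I₂) lam mu B₂) ∧
      IsUnit (rootS (E := specH B I₂) (F := specK B I₂) lam mu B₂) ∧
      ∃ W : WithLp 2 ((B.rangeᗮ : Submodule ℂ H) × WithLp 2 (B.ker ×
              WithLp 2 (WithLp 2 (specH B I₁ × specK B I₁) ×
                WithLp 2 (specH B I₂ × specK B I₂)))) ≃ₗᵢ[ℂ] WithLp 2 (H × K),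
        (∀ (x : (B.rangeᗮ : Submodule ℂ H)) (y : B.ker) (h₁ : specH B I₁) (k₁ : specK B I₁)
            (h₂ : specH B I₂) (k₂ : specK B I₂),
          W (WithLp.toLp 2 (x, WithLp.toLp 2 (y, WithLp.toLp 2
              (WithLp.toLp 2 (h₁, k₁), WithLp.toLp 2 (h₂, k₂))))) =
            WithLp.toLp 2 ((x : H) + ((h₁ : rangeClosure B) : H) + ((h₂ : rangeClosure B) : H),
              (y : K) + ((k₁ : kerPerp B) : K) + ((k₂ : kerPerp B) : K))) ∧
        ∀ z, opAbs (Qop lam mu B) (W z) =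
          W (directSumOp (((|lam| : ℝ) : ℂ) • 1)
              (directSumOp (((|mu| : ℝ) : ℂ) • 1)
                (directSumOp (((|lam| : ℝ) : ℂ) • lowBlock lam mu B₁)
                  (highBlock lam mu B₂))) z)) ∧
    -- only `lam` vanishes
    (lam = 0 → mu ≠ 0 →
      let S : K →L[ℂ] K := opSqrt (((mu ^ 2 : ℝ) : ℂ) • 1 + (4 : ℂ) • (B† ∘L B))
      IsUnit S ∧
      opAbs (Qop lam mu B) =
        blockOp ((2 : ℂ) • (B ∘L Ring.inverse S ∘L B†))
          ((mu : ℂ) • (B ∘L Ring.inverse S))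
          ((mu : ℂ) • (Ring.inverse S ∘L B†))
          ((1 / 2 : ℂ) • (S + ((mu ^ 2 : ℝ) : ℂ) • Ring.inverse S))) := by
  refine ⟨?_, ?_, ?_, ?_, ?_, ?_⟩
  · rintro rfl rfl
    exact opAbs_Qop_zero_zero B
  · rintro hl rfl
    have hT : opSqrt (((lam ^ 2 : ℝ) : ℂ) • 1 + (4 : ℂ) • (B ∘L B†)) = rootT lam 0 B := by
      rw [rootT, zero_sub, neg_sq]
    intro T
    simp only [T, hT]
    exact opAbs_Qop_of_mu_eq_zero hl B
  · intro h0 h1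
    refine opAbs_Qop_of_norm_le (by linarith [mul_comm lam mu]) fun y => ?_
    calc ‖B y‖ ^ 2 ≤ (‖B‖ * ‖y‖) ^ 2 := by gcongr; exact B.le_opNorm y
      _ = ‖B‖ ^ 2 * ‖y‖ ^ 2 := mul_pow _ _ _
      _ ≤ lam * mu * ‖y‖ ^ 2 := by
        rw [mul_comm lam mu]; gcongr
  · exact fun h => opAbs_Qop_of_mul_neg h B
  · intro h0 _ I₁ I₂ B₁ B₂
    have hlow := norm_opPart_Icc_apply_sq_le B (c := mu * lam)
    have hadj := le_norm_opPartAdjoint_Ioc_apply_sq B (c := mu * lam)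
    have hhigh := le_norm_opPart_Ioc_apply_sq B (c := mu * lam)
    have horth := inner_specH_Icc_specH_Ioc B (c := mu * lam)
    have hsup := exists_specH_Icc_add_specH_Ioc B (c := mu * lam)
    have hinv₁ := opSqrt_mem_specH_Icc B (c := mu * lam)
    have hinv₂ := opSqrt_mem_specH_Ioc B (c := mu * lam)
    exact exists_unitary_opAbs_Qop B h0 hinv₁ hinv₂ horth hsup hlow hadj hhigh
  · rintro rfl hm
    have hS : opSqrt (((mu ^ 2 : ℝ) : ℂ) • 1 + (4 : ℂ) • (B† ∘L B)) = rootS 0 mu B := by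
      rw [rootS, sub_zero]
    intro S
    simp only [S, hS]
    exact opAbs_Qop_of_lam_eq_zero hm B
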